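/- **Setting.** Let $d\in\mathbb N$, $\mathbb S^d=\{x\in\mathbb R^{d+1}:\|x\|=1\}$ with surface measure $\nu$, and let $\mu$ be the normalized Haar measure on $SO(d+1)$. Let $X$ be a random vector in $\mathbb S^d$ with square integrable density $f_X$ with respect to $\nu$, and let $U$ be a random element of $SO(d+1)$, independent of $X$, with square integrable density $f_U$ with respect to $\mu$; put $Z=UX$. For $l\in\mathbb N_0$ let $\mathfrak B^l$ be the space of spherical harmonics of degree $l$ on $\mathbb S^d$ (restrictions to $\mathbb S^d$ of complex harmonic homogeneous polynomials of degree $l$ in $d+1$ variables), let $N(d,l)$ be its dimension, that is, $N(d,0)=1$ and $N(d,l)=\frac{(2l+d-1)\,(l+d-2)!}{l!\,(d-1)!}$ for $l\ge1$, and let $\{B^l_q:1\le q\le N(d,l)\}$ be any orthonormal basis of $\mathfrak B^l$ in $L^2((\mathbb S^d,\nu),\mathbb C)$. Let $\tilde\phi^l(f_U)$ be the $N(d,l)\times N(d,l)$ matrix with entries $$\tilde\phi^l_{qr}(f_U)=\int_{SO(d+1)}f_U(u)\Big(\int_{\mathbb S^d}\overline{B^l_q(ux)}\,B^l_r(x)\,d\nu(x)\Big)d\mu(u),$$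 and assume that $\tilde\phi^l(f_U)$ is invertible for every $l\in\mathbb N_0$. For $T>0$ put $$K_T(x,z)=\sum_{l=0}^{\lfloor T\rfloor}\sum_{q=1}^{N(d,l)}\Big(\sum_{r=1}^{N(d,l)}(\tilde\phi^l(f_U))^{-1}_{qr}\,\overline{B^l_r(z)}\Big)B^l_q(x).$$ Let $(T_n)$ be a sequence of positive reals with $T_n\to\infty$, and let $\|\cdot\|_{\rm op}$ be the operator norm of complex matrices for the standard Hermitian norm. For sequences, $a_n\gtrsim b_n$ means that there is a constant $c>0$ with $a_n\ge c\,b_n$ for all $n$. **Lemma (rate of the denominator).** Assume that $f_X$ is bounded away from zero on $\mathbb S^d$ and that either $d=1$, or $d=2$ and for every $l\in\mathbb N_0$ there is a real $s_l\ne0$ with $\tilde\phi^l(f_U)=s_l I_{N(d,l)}$. Then: 1. (Ordinary-smooth case.) Let $\beta\ge0$. If there is $c_2>0$ with $\|(\tilde\phi^l(f_U))^{-1}\|_{\rm op}\ge c_2\,l^{\beta}$ for all $l\ge1$, then for each $x\in\mathbb S^d$, $\mathbb E\big((\operatorname{Re}K_{T_n}(x,Z))^2\big)\gtrsim T_n^{2\beta+d}$.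 2. (Super-smooth case.) Let $\alpha\in\mathbb R$ and $\beta,\gamma>0$. If there is $c_2>0$ with $\|(\tilde\phi^l(f_U))^{-1}\|_{\rm op}\ge c_2\,l^{\alpha}\exp(\gamma l^\beta)$ for all $l\ge1$, then for each $x\in\mathbb S^d$ and each $0<\eta<1$, $\mathbb E\big((\operatorname{Re}K_{T_n}(x,Z))^2\big)\gtrsim T_n^{2\alpha+d}\exp\big(2\gamma(\eta T_n)^\beta\big)$. 3. (Log-super-smooth case.) Let $\alpha,\xi_2\in\mathbb R$ and $\beta,\gamma>0$. If there is $c_2>0$ with $\|(\tilde\phi^l(f_U))^{-1}\|_{\rm op}\ge c_2\,l^{\alpha}\exp\big(\gamma l^\beta(\log l-\xi_2)\big)$ for all $l\ge1$, then there is $\zeta\in\mathbb R$ such that for each $x\in\mathbb S^d$ and each $0<\eta<1$, $\mathbb E\big((\operatorname{Re}K_{T_n}(x,Z))^2\big)\gtrsim T_n^{2\alpha+d}\exp\big(2\gamma(\eta T_n)^\beta(\log T_n-\zeta)\big)$. Moreover, for all $n$ and all $x\in\mathbb S^d$, $$\int_{\mathbb S^d}(\operatorname{Re}K_{T_n}(x,z))^2\,d\nu(z)\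 \ge\ \int_{\mathbb S^d}(\operatorname{Im}K_{T_n}(x,z))^2\,d\nu(z).$$ -/

import Mathlib

open MeasureTheory ProbabilityTheory Filter Topology
open scoped ComplexConjugate

noncomputable section

namespace SphereDeconv

/-- The unit hypersphere of dimension `d` in `ℝ^(d+1)`. -/
abbrev Sph (d : ℕ) : Type := Metric.sphere (0 : EuclideanSpace ℝ (Fin (d + 1))) 1

/-- The scaled spherical (surface) measure `ν`; its total mass is the area of the sphere. -/
abbrev nu (d : ℕ) : Measure (Sph d) :=
  (volume : Measure (EuclideanSpace ℝ (Fin (d + 1)))).toSphere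

/-- The group of `(d+1) × (d+1)` real special orthogonal matrices. -/
abbrev SO (d : ℕ) : Type := Matrix.specialOrthogonalGroup (Fin (d + 1)) ℝ

instance (d : ℕ) : MeasurableSpace (SO d) := borel (SO d)

instance (d : ℕ) : BorelSpace (SO d) := ⟨rfl⟩

instance (d : ℕ) : IsTopologicalGroup (SO d) where
  continuous_mul := continuous_mul
  continuous_inv := by
    refine Continuous.subtype_mk (f := fun u : SO d => star u.1) ?_ _
    exact continuous_subtype_val.star

instance (d : ℕ) : CompactSpace (SO d) := by
  have hclosed : IsClosed
      ((Matrix.specialOrthogonalGroup (Fin (d + 1)) ℝ : Set (Matrix (Fin (d + 1)) (Fin (d + 1)) ℝ))) := by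
    have : (Matrix.specialOrthogonalGroup (Fin (d + 1)) ℝ :
        Set (Matrix (Fin (d + 1)) (Fin (d + 1)) ℝ)) =
        {A | A * A.transpose = 1} ∩ {A | A.det = 1} := by
      ext A
      simp only [SetLike.mem_coe, Matrix.mem_specialOrthogonalGroup_iff,
        Matrix.mem_orthogonalGroup_iff, Set.mem_inter_iff, Set.mem_ofPred_eq]
    rw [this]
    exact (isClosed_eq (by fun_prop) continuous_const).inter
      (isClosed_eq (by fun_prop) continuous_const)
  have hsub : (Matrix.specialOrthogonalGroup (Fin (d + 1)) ℝ :
      Set (Matrix (Fin (d + 1)) (Fin (d + 1)) ℝ)) ⊆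
      Set.pi Set.univ (fun _ => Set.pi Set.univ (fun _ => Set.Icc (-1 : ℝ) 1)) := by
    intro A hA i _ j _
    have h := entry_norm_bound_of_unitary
      (Matrix.mem_specialOrthogonalGroup_iff.1 hA).1 i j
    rw [Real.norm_eq_abs] at h
    exact abs_le.1 h
  exact isCompact_iff_compactSpace.1
    ((isCompact_univ_pi fun _ => isCompact_univ_pi fun _ => isCompact_Icc).of_isClosed_subset
      hclosed hsub)

/-- The normalized Haar measure on `SO(d+1)`. -/
def haarSO (d : ℕ) : Measure (SO d) := Measure.haarMeasure ⊤

/-- The rotated point `u x`. -/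
def rot {d : ℕ} (u : SO d) (x : Sph d) : Sph d :=
  ⟨Matrix.toEuclideanLin u.1 x.1, by
    have hu : u.1.transpose * u.1 = 1 :=
      (Matrix.mem_orthogonalGroup_iff' (Fin (d + 1)) ℝ).1
        (Matrix.mem_specialOrthogonalGroup_iff.1 u.2).1
    have hx : ‖x.1‖ = 1 := by simp
    have h2 : ‖Matrix.toEuclideanLin u.1 x.1‖ ^ 2 = ‖x.1‖ ^ 2 := by
      have key : (u.1.mulVec x.1.ofLp) ⬝ᵥ (u.1.mulVec x.1.ofLp) = x.1.ofLp ⬝ᵥ x.1.ofLp := by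
        rw [Matrix.dotProduct_mulVec, ← Matrix.mulVec_transpose, Matrix.mulVec_mulVec, hu,
          Matrix.one_mulVec]
      rw [EuclideanSpace.real_norm_sq_eq, EuclideanSpace.real_norm_sq_eq]
      simpa [dotProduct, sq] using key
    rw [mem_sphere_zero_iff_norm]
    rw [hx] at h2
    nlinarith [norm_nonneg (Matrix.toEuclideanLin u.1 x.1)]⟩

/-- The Laplacian on complex polynomials in `d+1` variables. -/
def polyLaplacian (d : ℕ) :
    MvPolynomial (Fin (d + 1)) ℂ →ₗ[ℂ] MvPolynomial (Fin (d + 1)) ℂ :=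
  ∑ i, (MvPolynomial.pderiv i).toLinearMap ∘ₗ (MvPolynomial.pderiv i).toLinearMap

/-- Restriction to the sphere of the function defined by a polynomial. -/
def restrictSph (d : ℕ) : MvPolynomial (Fin (d + 1)) ℂ →ₗ[ℂ] (Sph d → ℂ) :=
  LinearMap.pi fun x => (MvPolynomial.aeval fun i => ((x.1 i : ℝ) : ℂ)).toLinearMap

/-- The space of spherical harmonics of degree `l` in `d+1` variables: the restrictions to the
sphere of the harmonic homogeneous polynomials of degree `l`. -/
def harmonicSpace (d l : ℕ) : Submodule ℂ (Sph d → ℂ) :=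
  (MvPolynomial.homogeneousSubmodule (Fin (d + 1)) ℂ l ⊓
    LinearMap.ker (polyLaplacian d)).map (restrictSph d)

/-- The dimension `N(d,l) = (2l+d-1) (l+d-2)! / (l! (d-1)!)` of the space of spherical harmonics
of degree `l` (`d ≥ 1`), with `N(d,0) = 1`. -/
def harmDim (d l : ℕ) : ℕ :=
  if l = 0 then 1
  else ((2 * l + d - 1) * (l + d - 2).factorial) / (l.factorial * (d - 1).factorial)

/-- `b` is an orthonormal basis of the space of spherical harmonics of degree `l` with respect
to the inner product of `L²(ν)`. -/
structure IsHarmonicONB (d l : ℕ) (b : Fin (harmDim d l) → Sph d → ℂ) : Prop where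
  orthonormal : ∀ q r, ∫ x, b q x * conj (b r x) ∂(nu d) = if q = r then 1 else 0
  span_eq : Submodule.span ℂ (Set.range b) = harmonicSpace d l

section Estimator

variable {d : ℕ} (B : (l : ℕ) → Fin (harmDim d l) → Sph d → ℂ)

/-- `D^l_{qr}(u) = ∫ conj (B^l_q (u x)) B^l_r(x) dν(x)`. -/
def rotCoeff (l : ℕ) (q r : Fin (harmDim d l)) (u : SO d) : ℂ :=
  ∫ x, conj (B l q (rot u x)) * B l r x ∂(nu d)

/-- The rotational Fourier transform of `g` at degree `l`: the matrix with entries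
`∫ g(u) D^l_{qr}(u) dμ(u)`, with `μ` the normalized Haar measure. -/
def rotFourier (g : SO d → ℝ) (l : ℕ) :
    Matrix (Fin (harmDim d l)) (Fin (harmDim d l)) ℂ :=
  Matrix.of fun q r => ∫ u, (g u : ℂ) * rotCoeff B l q r u ∂(haarSO d)

/-- The deconvolution kernel `K_T(x,z)`. -/
def kernelK (fU : SO d → ℝ) (T : ℝ) (x z : Sph d) : ℂ :=
  ∑ l ∈ Finset.range (⌊T⌋₊ + 1), ∑ q,
    (∑ r, (rotFourier B fU l)⁻¹ q r * conj (B l r z)) * B l q x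

/-- The operator norm, for the Hermitian norm, of the inverse of the rotational Fourier
transform at degree `l`. -/
def invOpNorm (fU : SO d → ℝ) (l : ℕ) : ℝ :=
  ‖Matrix.toEuclideanCLM (n := Fin (harmDim d l)) (𝕜 := ℂ) (rotFourier B fU l)⁻¹‖

/-- Lower-bound part of the ordinary-smooth scenario of order `β`. -/
def SmoothLower1 (fU : SO d → ℝ) (β : ℝ) : Prop :=
  ∃ c₂ : ℝ, 0 < c₂ ∧ ∀ l : ℕ, 1 ≤ l → c₂ * (l : ℝ) ^ β ≤ invOpNorm B fU l

/-- Lower-bound part of the super-smooth scenario of order `β`. -/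
def SmoothLower2 (fU : SO d → ℝ) (α β γ : ℝ) : Prop :=
  ∃ c₂ : ℝ, 0 < c₂ ∧ ∀ l : ℕ, 1 ≤ l →
    c₂ * (l : ℝ) ^ α * Real.exp (γ * (l : ℝ) ^ β) ≤ invOpNorm B fU l

/-- Lower-bound part of the log-super-smooth scenario of order `β`. -/
def SmoothLower3 (fU : SO d → ℝ) (α β γ ξ₂ : ℝ) : Prop :=
  ∃ c₂ : ℝ, 0 < c₂ ∧ ∀ l : ℕ, 1 ≤ l →
    c₂ * (l : ℝ) ^ α * Real.exp (γ * (l : ℝ) ^ β * (Real.log l - ξ₂)) ≤ invOpNorm B fU l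

end Estimator

/-- Variance lower bound with exponent `q` in the ordinary-smooth scenario, for the second
moments `M n x`. -/
def VarLower1 {d : ℕ} (M : ℕ → Sph d → ℝ) (T : ℕ → ℝ) (β q : ℝ) : Prop :=
  ∀ x : Sph d, ∃ c : ℝ, 0 < c ∧ ∀ n, c * T n ^ (2 * β + q) ≤ M n x

/-- Variance lower bound with exponent `q` in the super-smooth scenario. -/
def VarLower2 {d : ℕ} (M : ℕ → Sph d → ℝ) (T : ℕ → ℝ) (α β γ q : ℝ) : Prop :=
  ∀ x : Sph d, ∀ η : ℝ, 0 < η → η < 1 → ∃ c : ℝ, 0 < c ∧ ∀ n,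
    c * (T n ^ (2 * α + q) * Real.exp (2 * γ * (η * T n) ^ β)) ≤ M n x

/-- Variance lower bound with exponent `q` in the log-super-smooth scenario. -/
def VarLower3 {d : ℕ} (M : ℕ → Sph d → ℝ) (T : ℕ → ℝ) (α β γ q : ℝ) : Prop :=
  ∃ ζ : ℝ, ∀ x : Sph d, ∀ η : ℝ, 0 < η → η < 1 → ∃ c : ℝ, 0 < c ∧ ∀ n,
    c * (T n ^ (2 * α + q) * Real.exp (2 * γ * (η * T n) ^ β * (Real.log (T n) - ζ))) ≤ M n x

end SphereDeconv

end

noncomputable section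

namespace SphereDeconv

/-! Since `fX ≥ c > 0` and `nu` is rotation invariant, the law of `Z = UX` dominates `c • nu`, so
the second moment is at least `c` times the squared `L²(nu)` norm of `Re K_T(x, ·)`.

The kernel is real. Conjugation acts on an orthonormal basis of harmonics through a symmetric
unitary matrix `M`, and `fU` is real, so `conj φ = Mᴴ φ M`; the `M`s cancel in each degree
(`IsHarmonicONB.conj_kernelPart`). The comparison of real and imaginary parts is then trivial, and
orthogonality of distinct degrees makes the squared norm the sum over `l ≤ ⌊T⌋` of `‖(φ⁻¹)ᵀ
B^l(x)‖²` (`integral_kernelK_re_sq`).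

An operator norm bounds `(φ⁻¹)ᵀ v` from below only if no direction is favoured. This is what the
assumption on `d` gives: `φ φᴴ` is a positive multiple of the identity. For `d = 2` it is immediate;
for `d = 1` the exponentials diagonalize `φ` with entries `a, conj a`. As `∑ ‖B^l_q(x)‖²` is
`N(d,l)` divided by the area, the norm is bounded below by a multiple of `∑ ‖φ⁻¹‖² N(d,l)`
(`le_integral_kernelK_re_sq`), where `N(d,l) ≥ l^(d-1)`.

In the ordinary-smooth case the upper half of this sum gives the rate. In the other two the term `l
= ⌊T⌋` suffices: the missing factor `T` and the rounding are absorbed by lowering the exponential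
rate through `η < 1`. -/

/-! ### Isometries of the sphere and invariance of the surface measure. -/

/-- The action of a linear isometry on the unit sphere. -/
def isoSph {d : ℕ} (g : EuclideanSpace ℝ (Fin (d + 1)) ≃ₗᵢ[ℝ] EuclideanSpace ℝ (Fin (d + 1)))
    (x : Sph d) : Sph d :=
  ⟨g x.1, by simp⟩

theorem continuous_isoSph {d : ℕ}
    (g : EuclideanSpace ℝ (Fin (d + 1)) ≃ₗᵢ[ℝ] EuclideanSpace ℝ (Fin (d + 1))) :
    Continuous (isoSph g) :=
  (g.continuous.comp continuous_subtype_val).subtype_mk _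

/-- The surface measure of a set is a multiple of the volume of the cone over it; a linear isometry
maps cones to cones and preserves volume. -/
theorem measurePreserving_isoSph {d : ℕ}
    (g : EuclideanSpace ℝ (Fin (d + 1)) ≃ₗᵢ[ℝ] EuclideanSpace ℝ (Fin (d + 1))) :
    MeasurePreserving (isoSph g) (nu d) (nu d) := by
  refine ⟨(continuous_isoSph g).measurable, ?_⟩
  ext s hs
  rw [Measure.map_apply (continuous_isoSph g).measurable hs,
    Measure.toSphere_apply' _ ((continuous_isoSph g).measurable hs),
    Measure.toSphere_apply' _ hs]
  congr 1
  conv_rhs => rw [← g.measurePreserving.measure_preimage_emb g.toHomeomorph.measurableEmbedding]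
  congr 1
  ext y
  simp only [Set.mem_smul, Set.mem_image, Set.mem_preimage]
  constructor
  · rintro ⟨r, hr, _, ⟨x, hx, rfl⟩, rfl⟩
    exact ⟨r, hr, _, ⟨isoSph g x, hx, rfl⟩, by simp [isoSph]⟩
  · rintro ⟨r, hr, _, ⟨x, hx, rfl⟩, h⟩
    refine ⟨r, hr, _, ⟨isoSph g.symm x, ?_, rfl⟩, ?_⟩
    · have : isoSph g (isoSph g.symm x) = x := by ext1; simp [isoSph]
      rw [this]; exact hx
    · apply g.injective
      simp [isoSph, h]

theorem integral_isoSph {d : ℕ} {F : Type*} [NormedAddCommGroup F] [NormedSpace ℝ F]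
    (g : EuclideanSpace ℝ (Fin (d + 1)) ≃ₗᵢ[ℝ] EuclideanSpace ℝ (Fin (d + 1)))
    {f : Sph d → F} (hf : Continuous f) :
    ∫ x, f (isoSph g x) ∂(nu d) = ∫ x, f x ∂(nu d) := by
  have h := (measurePreserving_isoSph g).map_eq
  conv_rhs => rw [← h]
  rw [integral_map (continuous_isoSph g).aemeasurable]
  exact hf.aestronglyMeasurable

theorem exists_isoSph_eq {d : ℕ} (x y : Sph d) : ∃ g, isoSph g x = y := by
  -- A reflection is enough: the harmonic spaces and `nu` are invariant under all isometries, not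
  -- only rotations.
  refine ⟨(Submodule.span ℝ {x.1 - y.1})ᗮ.reflection, ?_⟩
  ext1
  exact Submodule.reflection_sub (by simp)

theorem exists_isoSph_eq_rot {d : ℕ} (u : SO d) : ∃ g, ∀ x, rot u x = isoSph g x := by
  have hu : u.1.transpose * u.1 = 1 :=
    (Matrix.mem_orthogonalGroup_iff' (Fin (d + 1)) ℝ).1
      (Matrix.mem_specialOrthogonalGroup_iff.1 u.2).1
  let f : EuclideanSpace ℝ (Fin (d + 1)) →ₗᵢ[ℝ] EuclideanSpace ℝ (Fin (d + 1)) :=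
    ⟨Matrix.toEuclideanLin u.1, fun x => by
      have key : (u.1.mulVec x.ofLp) ⬝ᵥ (u.1.mulVec x.ofLp) = x.ofLp ⬝ᵥ x.ofLp := by
        rw [Matrix.dotProduct_mulVec, ← Matrix.mulVec_transpose, Matrix.mulVec_mulVec, hu,
          Matrix.one_mulVec]
      rw [← sq_eq_sq₀ (norm_nonneg _) (norm_nonneg _), EuclideanSpace.real_norm_sq_eq,
        EuclideanSpace.real_norm_sq_eq]
      simpa [dotProduct, sq] using key⟩
  exact ⟨f.toLinearIsometryEquiv rfl, fun x => rfl⟩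

theorem continuous_rot {d : ℕ} : Continuous fun p : SO d × Sph d => rot p.1 p.2 := by
  refine Continuous.subtype_mk (?_ : Continuous
    fun p : SO d × Sph d => Matrix.toEuclideanLin p.1.1 p.2.1) _
  simp only [Matrix.toLpLin_apply]
  refine (PiLp.continuous_toLp 2 _).comp ?_
  exact Continuous.matrix_mulVec (continuous_subtype_val.comp continuous_fst)
    ((PiLp.continuous_ofLp 2 _).comp (continuous_subtype_val.comp continuous_snd))

theorem integrable_sph {d : ℕ} {F : Type*} [NormedAddCommGroup F] {m : Measure (Sph d)}
    [IsFiniteMeasure m] {f : Sph d → F} (hf : Continuous f) : Integrable f m :=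
  hf.integrable_of_hasCompactSupport (HasCompactSupport.of_compactSpace f)

/-! ### Infinitesimal rotations and orthogonality of harmonics of different degrees. -/

/-- The rotation by the angle `t` in the plane of the coordinates `i` and `j`. -/
def planeRot {d : ℕ} {i j : Fin (d + 1)} (hij : i ≠ j) (t : ℝ) :
    EuclideanSpace ℝ (Fin (d + 1)) ≃ₗᵢ[ℝ] EuclideanSpace ℝ (Fin (d + 1)) :=
  LinearIsometry.toLinearIsometryEquiv (li :=
    { toFun := fun x => WithLp.toLp 2 fun k =>
        if k = i then Real.cos t * x i - Real.sin t * x j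
        else if k = j then Real.sin t * x i + Real.cos t * x j else x k
      map_add' := fun x y => by
        ext k
        simp only [PiLp.add_apply]
        split_ifs <;> ring
      map_smul' := fun c x => by
        ext k
        simp only [PiLp.smul_apply, smul_eq_mul, RingHom.id_apply]
        split_ifs <;> ring
      norm_map' := fun x => by
        rw [← sq_eq_sq₀ (norm_nonneg _) (norm_nonneg _), EuclideanSpace.real_norm_sq_eq,
          EuclideanSpace.real_norm_sq_eq, ← sub_eq_zero, ← Finset.sum_sub_distrib,
          Finset.sum_eq_add i j hij]
        · simp only [LinearMap.coe_mk, AddHom.coe_mk, if_true, if_neg hij.symm]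
          linear_combination (x i ^ 2 + x j ^ 2) * Real.sin_sq_add_cos_sq t
        · rintro k - ⟨hki, hkj⟩
          simp [hki, hkj]
        · simp
        · simp }) rfl

theorem planeRot_apply {d : ℕ} {i j : Fin (d + 1)} (hij : i ≠ j) (t : ℝ)
    (x : EuclideanSpace ℝ (Fin (d + 1))) (k : Fin (d + 1)) :
    planeRot hij t x k = if k = i then Real.cos t * x i - Real.sin t * x j
        else if k = j then Real.sin t * x i + Real.cos t * x j else x k :=
  rfl

open MvPolynomial in
/-- The infinitesimal rotation in the plane of the coordinates `i` and `j`. -/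
def rotDeriv {d : ℕ} (i j : Fin (d + 1)) :
    Derivation ℂ (MvPolynomial (Fin (d + 1)) ℂ) (MvPolynomial (Fin (d + 1)) ℂ) :=
  (X i : MvPolynomial (Fin (d + 1)) ℂ) • pderiv j - (X j : MvPolynomial (Fin (d + 1)) ℂ) • pderiv i

open MvPolynomial in
theorem rotDeriv_apply {d : ℕ} (i j : Fin (d + 1)) (p : MvPolynomial (Fin (d + 1)) ℂ) :
    rotDeriv i j p = X i * pderiv j p - X j * pderiv i p := by
  simp [rotDeriv]

theorem restrictSph_apply {d : ℕ} (p : MvPolynomial (Fin (d + 1)) ℂ) (x : Sph d) :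
    restrictSph d p x = MvPolynomial.aeval (fun i => ((x.1 i : ℝ) : ℂ)) p :=
  rfl

theorem restrictSph_mul {d : ℕ} (p q : MvPolynomial (Fin (d + 1)) ℂ) (x : Sph d) :
    restrictSph d (p * q) x = restrictSph d p x * restrictSph d q x := by
  simp [restrictSph_apply]

theorem continuous_restrictSph {d : ℕ} (p : MvPolynomial (Fin (d + 1)) ℂ) :
    Continuous (restrictSph d p) := by
  induction p using MvPolynomial.induction_on with
  | C a =>
    have h : restrictSph d (MvPolynomial.C a) = fun _ => a :=
      funext fun x => by simp [restrictSph_apply]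
    rw [h]
    exact continuous_const
  | add p q hp hq => rw [map_add]; exact hp.add hq
  | mul_X p i hp =>
    rw [funext fun x => restrictSph_mul p (MvPolynomial.X i) x]
    refine hp.mul ?_
    have h : restrictSph d (MvPolynomial.X i) = fun x => ((x.1 i : ℝ) : ℂ) :=
      funext fun x => by simp [restrictSph_apply]
    rw [h]
    fun_prop

/-- Both sides obey the Leibniz rule, so only the coordinate functions have to be differentiated
along the orbit. -/
theorem hasDerivAt_restrictSph_planeRot {d : ℕ} {i j : Fin (d + 1)} (hij : i ≠ j)
    (p : MvPolynomial (Fin (d + 1)) ℂ) (x : Sph d) (t : ℝ) :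
    HasDerivAt (fun t : ℝ => restrictSph d p (isoSph (planeRot hij t) x))
      (restrictSph d (rotDeriv i j p) (isoSph (planeRot hij t) x)) t := by
  induction p using MvPolynomial.induction_on with
  | C a =>
    simp only [rotDeriv_apply, MvPolynomial.pderiv_C, mul_zero, sub_zero, map_zero,
      restrictSph_apply, MvPolynomial.aeval_C]
    exact hasDerivAt_const _ _
  | add p q hp hq => simp only [map_add]; exact hp.add hq
  | mul_X p k hp =>
    have hX : HasDerivAt (fun t : ℝ => restrictSph d (MvPolynomial.X k) (isoSph (planeRot hij t) x))
        (restrictSph d (rotDeriv i j (MvPolynomial.X k)) (isoSph (planeRot hij t) x)) t := by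
      have hr : HasDerivAt (fun t : ℝ => planeRot hij t x.1 k)
          (if k = i then - planeRot hij t x.1 j else if k = j then planeRot hij t x.1 i else 0) t := by
        simp only [planeRot_apply, if_true, if_neg hij.symm]
        split_ifs
        · exact (((Real.hasDerivAt_cos t).mul_const (x.1 i)).sub
            ((Real.hasDerivAt_sin t).mul_const (x.1 j))).congr_deriv (by ring)
        · exact (((Real.hasDerivAt_sin t).mul_const (x.1 i)).add
            ((Real.hasDerivAt_cos t).mul_const (x.1 j))).congr_deriv (by ring)
        · exact hasDerivAt_const _ _
      simp only [restrictSph_apply, MvPolynomial.aeval_X, rotDeriv_apply, MvPolynomial.pderiv_X]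
      refine hr.ofReal_comp.congr_deriv ?_
      by_cases hki : k = i
      · subst hki
        simp [isoSph, hij]
      · by_cases hkj : k = j
        · subst hkj
          simp [isoSph, hki]
        · simp [hki, hkj]
    have h := hp.mul hX
    refine (HasDerivAt.congr_deriv h ?_).congr_of_eventuallyEq
      (.of_forall fun t => restrictSph_mul _ _ _)
    simp only [Derivation.leibniz, map_add, smul_eq_mul, Pi.add_apply, restrictSph_mul]
    ring

/-- By invariance of `nu`, the integral of `p` composed with the rotation of angle `t` does not
depend on `t`; differentiate under the integral. -/
theorem integral_rotDeriv {d : ℕ} {i j : Fin (d + 1)} (hij : i ≠ j)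
    (p : MvPolynomial (Fin (d + 1)) ℂ) :
    ∫ x, restrictSph d (rotDeriv i j p) x ∂(nu d) = 0 := by
  obtain ⟨C, hC⟩ := (isCompact_range (continuous_restrictSph (rotDeriv i j p))).isBounded.exists_norm_le
  have h := (hasDerivAt_integral_of_dominated_loc_of_deriv_le (μ := nu d) (x₀ := (0 : ℝ))
    (F := fun t x => restrictSph d p (isoSph (planeRot hij t) x))
    (F' := fun t x => restrictSph d (rotDeriv i j p) (isoSph (planeRot hij t) x))
    (bound := fun _ => C) (s := Set.univ) univ_mem
    (.of_forall fun t => ((continuous_restrictSph p).comp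
      (continuous_isoSph _)).aestronglyMeasurable)
    (integrable_sph ((continuous_restrictSph p).comp (continuous_isoSph _)))
    ((continuous_restrictSph _).comp (continuous_isoSph _)).aestronglyMeasurable
    (.of_forall fun x t _ => hC _ ⟨_, rfl⟩) (integrable_const _)
    (.of_forall fun x t _ => hasDerivAt_restrictSph_planeRot hij p x t)).2
  simp only [integral_isoSph _ (continuous_restrictSph p),
    integral_isoSph _ (continuous_restrictSph (rotDeriv i j p))] at h
  exact h.unique (hasDerivAt_const _ _)

theorem integral_rotDeriv_mul {d : ℕ} (i j : Fin (d + 1))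
    (p q : MvPolynomial (Fin (d + 1)) ℂ) :
    ∫ x, restrictSph d (rotDeriv i j p * q) x ∂(nu d) =
      - ∫ x, restrictSph d (p * rotDeriv i j q) x ∂(nu d) := by
  by_cases hij : i = j
  · subst hij
    simp [rotDeriv_apply]
  have h := integral_rotDeriv hij (p * q)
  rw [Derivation.leibniz, smul_eq_mul, smul_eq_mul, map_add] at h
  simp only [Pi.add_apply] at h
  rw [integral_add (integrable_sph (continuous_restrictSph _))
    (integrable_sph (continuous_restrictSph _)), mul_comm q] at h
  linear_combination h

/-- Each `rotDeriv i j` is antisymmetric, so its square is symmetric. The sum over ordered pairs is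
twice the spherical Laplacian. -/
theorem integral_sum_rotDeriv_sq {d : ℕ} (p q : MvPolynomial (Fin (d + 1)) ℂ) :
    ∫ x, restrictSph d ((∑ i, ∑ j, rotDeriv i j (rotDeriv i j p)) * q) x ∂(nu d) =
      ∫ x, restrictSph d (p * ∑ i, ∑ j, rotDeriv i j (rotDeriv i j q)) x ∂(nu d) := by
  simp only [Finset.sum_mul, Finset.mul_sum, map_sum, Finset.sum_apply]
  rw [integral_finsetSum _ fun i _ => integrable_sph
      (continuous_finsetSum _ fun j _ => continuous_restrictSph _),
    integral_finsetSum _ fun i _ => integrable_sph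
      (continuous_finsetSum _ fun j _ => continuous_restrictSph _)]
  refine Finset.sum_congr rfl fun i _ => ?_
  rw [integral_finsetSum _ fun j _ => integrable_sph (continuous_restrictSph _),
    integral_finsetSum _ fun j _ => integrable_sph (continuous_restrictSph _)]
  refine Finset.sum_congr rfl fun j _ => ?_
  rw [integral_rotDeriv_mul, integral_rotDeriv_mul, neg_neg]

-- Harmonic homogeneous polynomials are eigenvectors of twice the spherical Laplacian. The identity
-- holds for polynomials, by Euler's formula and the vanishing of the Laplacian.
open MvPolynomial in
theorem sum_rotDeriv_sq {d l : ℕ} {p : MvPolynomial (Fin (d + 1)) ℂ}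
    (hp : p.IsHomogeneous l) (hΔ : polyLaplacian d p = 0) :
    ∑ i, ∑ j, rotDeriv i j (rotDeriv i j p) =
      (-(2 * (l * (l + d - 1))) : ℂ) • p := by
  have hE := hp.sum_X_mul_pderiv
  have hL : ∑ i, pderiv i (pderiv i p) = 0 := by
    simpa [polyLaplacian] using hΔ
  have hcomm (i j : Fin (d + 1)) : pderiv j (pderiv i p) = pderiv i (pderiv j p) := by
    let D (k : Fin (d + 1)) :
      Derivation ℂ (MvPolynomial (Fin (d + 1)) ℂ) (MvPolynomial (Fin (d + 1)) ℂ) := pderiv k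
    -- A commutator of derivations is a derivation, so it vanishes once it kills the variables.
    have h : ⁅D j, D i⁆ = 0 := by
      refine MvPolynomial.derivation_ext fun k => ?_
      simp [D, Derivation.commutator_apply, pderiv_X, Pi.single_apply, apply_ite]
    have h2 : ⁅D j, D i⁆ p = 0 := by rw [h]; rfl
    rw [Derivation.commutator_apply] at h2
    exact sub_eq_zero.1 h2
  have hA : ∑ i, ∑ j, X i * pderiv j (X i * pderiv j p) = (l : ℂ) • p := by
    have h (i j : Fin (d + 1)) : X i * pderiv j (X i * pderiv j p) =
        X i * X i * pderiv j (pderiv j p) + if i = j then X i * pderiv j p else 0 := by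
      simp only [pderiv_mul, pderiv_X, Pi.single_apply]
      split_ifs <;> simp <;> ring
    simp only [h, Finset.sum_add_distrib, ← Finset.mul_sum, hL, mul_zero, zero_add,
      Finset.sum_ite_eq, Finset.mem_univ, if_true, hE]
    rw [Nat.cast_smul_eq_nsmul]
  have hB : ∑ i, ∑ j, X i * pderiv j (X j * pderiv i p) =
      ((d + 1) * l + ((l - 1 : ℕ) : ℂ) * l) • p := by
    have h (i j : Fin (d + 1)) : X i * pderiv j (X j * pderiv i p) =
        X i * pderiv i p + X j * (X i * pderiv i (pderiv j p)) := by
      simp only [pderiv_mul, pderiv_X_self, hcomm]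
      ring
    have h2 : ∑ i, ∑ j, X j * (X i * pderiv i (pderiv j p)) = (l - 1) • l • p := by
      rw [Finset.sum_comm]
      have h3 (j : Fin (d + 1)) : ∑ i, X i * pderiv i (pderiv j p) = (l - 1) • pderiv j p :=
        (IsHomogeneous.pderiv hp).sum_X_mul_pderiv
      simp only [← Finset.mul_sum, h3, mul_smul_comm]
      rw [← Finset.smul_sum, hE]
    simp only [h, Finset.sum_add_distrib, h2, Finset.sum_const, ← Finset.smul_sum, hE]
    simp only [Finset.card_univ, Fintype.card_fin, ← Nat.cast_smul_eq_nsmul ℂ, smul_smul, ← add_smul]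
    push_cast
    rfl
  -- The second pair of terms is the first with `i` and `j` exchanged, so the double sum is twice
  -- the difference of `hA` and `hB`.
  have hS (i j : Fin (d + 1)) : rotDeriv i j (rotDeriv i j p) =
      X i * pderiv j (X i * pderiv j p) - X i * pderiv j (X j * pderiv i p)
      + (X j * pderiv i (X j * pderiv i p) - X j * pderiv i (X i * pderiv j p)) := by
    simp only [rotDeriv_apply, map_sub]
    ring
  simp only [hS, Finset.sum_add_distrib, Finset.sum_sub_distrib]
  rw [Finset.sum_comm (f := fun i j => X j * pderiv i (X j * pderiv i p)),
    Finset.sum_comm (f := fun i j => X j * pderiv i (X i * pderiv j p)), hA, hB,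
    ← sub_smul, ← add_smul]
  congr 1
  rcases l with _ | l
  · simp
  · push_cast [Nat.add_sub_cancel]
    ring

/-- The eigenvalues differ: equality would give `(l - m)(l + m + d - 1) = 0`, and for `d ≥ 1` the
second factor vanishes only if `l = m = 0`. The pairing is bilinear; conjugates are handled by
`conj_mem_harmonicSpace`. -/
theorem integral_mul_harmonic_of_ne {d l m : ℕ} (hd : 1 ≤ d) (hlm : l ≠ m) {f g : Sph d → ℂ}
    (hf : f ∈ harmonicSpace d l) (hg : g ∈ harmonicSpace d m) :
    ∫ x, f x * g x ∂(nu d) = 0 := by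
  obtain ⟨p, ⟨hp, hpΔ⟩, rfl⟩ := hf
  obtain ⟨q, ⟨hq, hqΔ⟩, rfl⟩ := hg
  have h := integral_sum_rotDeriv_sq p q
  rw [sum_rotDeriv_sq ((MvPolynomial.mem_homogeneousSubmodule _ _).1 hp) hpΔ,
    sum_rotDeriv_sq ((MvPolynomial.mem_homogeneousSubmodule _ _).1 hq) hqΔ] at h
  simp only [smul_mul_assoc, mul_smul_comm, map_smul, Pi.smul_apply, restrictSph_mul,
    integral_smul] at h
  rw [← sub_eq_zero, ← sub_smul, smul_eq_zero] at h
  refine h.resolve_left fun h0 => hlm ?_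
  have h1 : ((l : ℂ) - m) * (l + m + d - 1) = 0 := by linear_combination (-1 / 2) * h0
  rcases mul_eq_zero.1 h1 with h2 | h2
  · exact_mod_cast sub_eq_zero.1 h2
  · have : (l + m + d : ℂ) = (1 : ℕ) := by push_cast; linear_combination h2
    have : l + m + d = 1 := by exact_mod_cast this
    omega

/-! ### Stability of the harmonic spaces under conjugation and isometries. -/

theorem continuous_of_mem_harmonicSpace {d l : ℕ} {f : Sph d → ℂ} (hf : f ∈ harmonicSpace d l) :
    Continuous f := by
  obtain ⟨p, -, rfl⟩ := hf
  exact continuous_restrictSph p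

theorem polyLaplacian_apply {d : ℕ} (p : MvPolynomial (Fin (d + 1)) ℂ) :
    polyLaplacian d p = ∑ i, MvPolynomial.pderiv i (MvPolynomial.pderiv i p) := by
  simp [polyLaplacian]

/-- The Laplacian has real coefficients and the points of the sphere are real, so it suffices to
conjugate the coefficients of the polynomial. -/
theorem conj_mem_harmonicSpace {d l : ℕ} {f : Sph d → ℂ} (hf : f ∈ harmonicSpace d l) :
    (fun x => conj (f x)) ∈ harmonicSpace d l := by
  obtain ⟨p, ⟨hp, hpΔ⟩, rfl⟩ := hf
  refine ⟨MvPolynomial.map (starRingEnd ℂ) p, ⟨?_, ?_⟩, ?_⟩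
  · exact MvPolynomial.IsHomogeneous.map hp _
  · have h : polyLaplacian d p = 0 := hpΔ
    change polyLaplacian d _ = 0
    rw [polyLaplacian_apply] at h ⊢
    simp only [MvPolynomial.pderiv_map, ← map_sum, h, map_zero]
  · ext x
    simp only [restrictSph_apply, MvPolynomial.aeval_def, MvPolynomial.eval₂_map]
    rw [MvPolynomial.hom_eval₂]
    simp only [Complex.conj_ofReal]
    rfl

/-- The linear change of variables given by a linear map of the Euclidean space. -/
def linSubst {d : ℕ} (g : EuclideanSpace ℝ (Fin (d + 1)) ≃ₗᵢ[ℝ] EuclideanSpace ℝ (Fin (d + 1))) :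
    MvPolynomial (Fin (d + 1)) ℂ →ₐ[ℂ] MvPolynomial (Fin (d + 1)) ℂ :=
  MvPolynomial.aeval fun j => ∑ k, MvPolynomial.C ((g (EuclideanSpace.single k 1) j : ℝ) : ℂ) *
    MvPolynomial.X k

theorem sum_mul_single_apply {d : ℕ}
    (g : EuclideanSpace ℝ (Fin (d + 1)) ≃ₗᵢ[ℝ] EuclideanSpace ℝ (Fin (d + 1)))
    (x : EuclideanSpace ℝ (Fin (d + 1))) (j : Fin (d + 1)) :
    ∑ k, g (EuclideanSpace.single k 1) j * x k = g x j := by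
  have h : x = ∑ k, x k • EuclideanSpace.single k (1 : ℝ) := by
    ext i
    simp [Finset.sum_apply, Pi.single_apply]
  conv_rhs => rw [h, map_sum]
  simp [mul_comm]

theorem sum_single_mul_single {d : ℕ}
    (g : EuclideanSpace ℝ (Fin (d + 1)) ≃ₗᵢ[ℝ] EuclideanSpace ℝ (Fin (d + 1)))
    (j k : Fin (d + 1)) :
    ∑ i, g (EuclideanSpace.single i 1) j * g (EuclideanSpace.single i 1) k =
      if j = k then 1 else 0 := by
  have h (i j : Fin (d + 1)) : g (EuclideanSpace.single i 1) j =
      g.symm (EuclideanSpace.single j 1) i := by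
    have h1 : inner ℝ (g (EuclideanSpace.single i 1)) (EuclideanSpace.single j (1 : ℝ)) =
        inner ℝ (EuclideanSpace.single i (1 : ℝ)) (g.symm (EuclideanSpace.single j 1)) := by
      rw [← g.symm.inner_map_map, g.symm_apply_apply]
    simpa [EuclideanSpace.inner_single_left, EuclideanSpace.inner_single_right] using h1
  have h2 : inner ℝ (g.symm (EuclideanSpace.single k (1 : ℝ))) (g.symm (EuclideanSpace.single j 1)) =
      if j = k then (1 : ℝ) else 0 := by
    rw [g.symm.inner_map_map]
    simp [EuclideanSpace.inner_single_left, eq_comm]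
  rw [← h2, PiLp.inner_apply]
  simp [h]

theorem pderiv_linSubst {d : ℕ}
    (g : EuclideanSpace ℝ (Fin (d + 1)) ≃ₗᵢ[ℝ] EuclideanSpace ℝ (Fin (d + 1)))
    (i : Fin (d + 1)) (p : MvPolynomial (Fin (d + 1)) ℂ) :
    MvPolynomial.pderiv i (linSubst g p) =
      ∑ j, MvPolynomial.C ((g (EuclideanSpace.single i 1) j : ℝ) : ℂ) *
        linSubst g (MvPolynomial.pderiv j p) := by
  induction p using MvPolynomial.induction_on with
  | C a => simp [linSubst, MvPolynomial.algebraMap_eq]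
  | add p q hp hq => simp only [map_add, hp, hq, mul_add, Finset.sum_add_distrib]
  | mul_X p k hp =>
    have hX : MvPolynomial.pderiv i (linSubst g (MvPolynomial.X k)) =
        MvPolynomial.C ((g (EuclideanSpace.single i 1) k : ℝ) : ℂ) := by
      simp [linSubst, MvPolynomial.pderiv_X, Pi.single_apply]
    simp only [map_mul, MvPolynomial.pderiv_mul, hX, hp, map_add, mul_add, Finset.sum_add_distrib,
      MvPolynomial.pderiv_X, Finset.sum_mul]
    congr 1
    · exact Finset.sum_congr rfl fun j _ => by ring
    · rw [Finset.sum_eq_single k]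
      · simp [mul_comm]
      · intro j _ hj
        simp [hj.symm]
      · simp

/-- By the chain rule the second derivatives are contracted with `g gᵀ`, which is the identity. -/
theorem polyLaplacian_linSubst {d : ℕ}
    (g : EuclideanSpace ℝ (Fin (d + 1)) ≃ₗᵢ[ℝ] EuclideanSpace ℝ (Fin (d + 1)))
    (p : MvPolynomial (Fin (d + 1)) ℂ) :
    polyLaplacian d (linSubst g p) = linSubst g (polyLaplacian d p) := by
  simp only [polyLaplacian_apply, pderiv_linSubst, map_sum, MvPolynomial.pderiv_C_mul,
    Finset.mul_sum]
  rw [Finset.sum_comm]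
  refine Finset.sum_congr rfl fun j _ => ?_
  rw [Finset.sum_comm]
  have h (k : Fin (d + 1)) : ∑ i, MvPolynomial.C ((g (EuclideanSpace.single i 1) j : ℝ) : ℂ) *
      (MvPolynomial.C ((g (EuclideanSpace.single i 1) k : ℝ) : ℂ) *
        linSubst g (MvPolynomial.pderiv k (MvPolynomial.pderiv j p))) =
      if j = k then linSubst g (MvPolynomial.pderiv k (MvPolynomial.pderiv j p)) else 0 := by
    simp only [← mul_assoc, ← Finset.sum_mul, ← map_mul, ← map_sum, ← Complex.ofReal_mul,
      ← Complex.ofReal_sum, sum_single_mul_single]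
    split_ifs <;> simp
  simp only [h, Finset.sum_ite_eq, Finset.mem_univ, if_true]

theorem comp_isoSph_mem_harmonicSpace {d l : ℕ}
    (g : EuclideanSpace ℝ (Fin (d + 1)) ≃ₗᵢ[ℝ] EuclideanSpace ℝ (Fin (d + 1)))
    {f : Sph d → ℂ} (hf : f ∈ harmonicSpace d l) :
    (fun x => f (isoSph g x)) ∈ harmonicSpace d l := by
  obtain ⟨p, ⟨hp, hpΔ⟩, rfl⟩ := hf
  refine ⟨linSubst g p, ⟨?_, ?_⟩, ?_⟩
  · have h := MvPolynomial.IsHomogeneous.aeval (n := 1) hp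
      (fun j => ∑ k, MvPolynomial.C ((g (EuclideanSpace.single k 1) j : ℝ) : ℂ) *
        MvPolynomial.X k) fun j => MvPolynomial.IsHomogeneous.sum _ _ _ fun k _ =>
          (MvPolynomial.isHomogeneous_X ℂ k).C_mul _
    rwa [one_mul] at h
  · have h : polyLaplacian d p = 0 := hpΔ
    change polyLaplacian d _ = 0
    rw [polyLaplacian_linSubst, h, map_zero]
  · ext x
    simp only [restrictSph_apply, linSubst, isoSph]
    rw [← AlgHom.comp_apply, MvPolynomial.comp_aeval]
    congr 2
    ext j
    rw [← sum_mul_single_apply g x.1 j]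
    simp

/-! ### Orthonormal bases, unitary changes of basis and the addition formula. -/

theorem integral_sum_mul_conj_sum {d : ℕ} {ι κ : Type*} [Fintype ι] [Fintype κ]
    {b : ι → Sph d → ℂ} {c : κ → Sph d → ℂ} (hb : ∀ i, Continuous (b i))
    (hc : ∀ k, Continuous (c k)) (a : ι → ℂ) (a' : κ → ℂ) :
    ∫ x, (∑ i, a i * b i x) * conj (∑ k, a' k * c k x) ∂(nu d) =
      ∑ i, ∑ k, a i * conj (a' k) * ∫ x, b i x * conj (c k x) ∂(nu d) := by
  have h (x : Sph d) : (∑ i, a i * b i x) * conj (∑ k, a' k * c k x) =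
      ∑ i, ∑ k, a i * conj (a' k) * (b i x * conj (c k x)) := by
    rw [map_sum, Finset.sum_mul_sum]
    refine Finset.sum_congr rfl fun i _ => Finset.sum_congr rfl fun k _ => ?_
    rw [map_mul]
    ring
  have hint (i : ι) (k : κ) : Continuous fun x => a i * conj (a' k) * (b i x * conj (c k x)) :=
    continuous_const.mul ((hb i).mul (Complex.continuous_conj.comp (hc k)))
  simp only [h]
  rw [integral_finsetSum _ fun i _ =>
    integrable_sph (continuous_finsetSum _ fun k _ => hint i k)]
  refine Finset.sum_congr rfl fun i _ => ?_
  rw [integral_finsetSum _ fun k _ => integrable_sph (hint i k)]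
  exact Finset.sum_congr rfl fun k _ => integral_const_mul _ _

namespace IsHarmonicONB

variable {d l : ℕ} {b : Fin (harmDim d l) → Sph d → ℂ}

theorem mem (hb : IsHarmonicONB d l b) (q : Fin (harmDim d l)) : b q ∈ harmonicSpace d l := by
  rw [← hb.span_eq]
  exact Submodule.subset_span ⟨q, rfl⟩

theorem continuous (hb : IsHarmonicONB d l b) (q : Fin (harmDim d l)) : Continuous (b q) :=
  continuous_of_mem_harmonicSpace (hb.mem q)

theorem integral_sum_mul_conj_sum (hb : IsHarmonicONB d l b) (a a' : Fin (harmDim d l) → ℂ) :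
    ∫ x, (∑ q, a q * b q x) * conj (∑ q, a' q * b q x) ∂(nu d) = ∑ q, a q * conj (a' q) := by
  rw [SphereDeconv.integral_sum_mul_conj_sum hb.continuous hb.continuous]
  simp [hb.orthonormal]

theorem eq_sum (hb : IsHarmonicONB d l b) {f : Sph d → ℂ} (hf : f ∈ harmonicSpace d l)
    (x : Sph d) : f x = ∑ q, (∫ y, f y * conj (b q y) ∂(nu d)) * b q x := by
  rw [← hb.span_eq] at hf
  obtain ⟨a, rfl⟩ := (Submodule.mem_span_range_iff_exists_fun ℂ).1 hf
  have h (r : Fin (harmDim d l)) :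
      ∫ y, (∑ q, a q • b q) y * conj (b r y) ∂(nu d) = a r := by
    have := hb.integral_sum_mul_conj_sum a (Pi.single r 1)
    simpa [Pi.single_apply, Finset.sum_apply, apply_ite conj] using this
  simp only [h]
  simp [Finset.sum_apply]

/-- The coefficients of a finite family in an orthonormal basis of spherical harmonics. -/
def _root_.SphereDeconv.coeffMatrix {d : ℕ} {ι κ : Type*} (c : κ → Sph d → ℂ)
    (b : ι → Sph d → ℂ) : Matrix κ ι ℂ :=
  Matrix.of fun k q => ∫ y, c k y * conj (b q y) ∂(nu d)

theorem coeffMatrix_mul_conjTranspose (hb : IsHarmonicONB d l b) {κ : Type*} [Fintype κ]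
    [DecidableEq κ] {c : κ → Sph d → ℂ} (hc : ∀ k, c k ∈ harmonicSpace d l)
    (horth : ∀ k k', ∫ x, c k x * conj (c k' x) ∂(nu d) = if k = k' then 1 else 0) :
    coeffMatrix c b * (coeffMatrix c b).conjTranspose = 1 := by
  ext k k'
  rw [Matrix.one_apply, ← horth]
  refine (hb.integral_sum_mul_conj_sum (coeffMatrix c b k) (coeffMatrix c b k')).symm.trans ?_
  simp only [coeffMatrix, Matrix.of_apply, ← hb.eq_sum (hc k), ← hb.eq_sum (hc k')]

/-- The cardinality condition makes the matrix square, so a one-sided inverse is two-sided. The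
index type stays general in order to accommodate `Fin 2` on the circle. -/
theorem conjTranspose_mul_coeffMatrix (hb : IsHarmonicONB d l b) {κ : Type*} [Fintype κ]
    [DecidableEq κ] (hκ : Fintype.card κ = harmDim d l)
    {c : κ → Sph d → ℂ} (hc : ∀ k, c k ∈ harmonicSpace d l)
    (horth : ∀ k k', ∫ x, c k x * conj (c k' x) ∂(nu d) = if k = k' then 1 else 0) :
    (coeffMatrix c b).conjTranspose * coeffMatrix c b = 1 :=
  (Matrix.mul_eq_one_comm_of_card_eq _ _ _ (by simpa using hκ)).1
    (hb.coeffMatrix_mul_conjTranspose hc horth)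

theorem eq_coeffMatrix_mulVec (hb : IsHarmonicONB d l b) {κ : Type*} {c : κ → Sph d → ℂ}
    (hc : ∀ k, c k ∈ harmonicSpace d l) (x : Sph d) :
    (fun k => c k x) = (coeffMatrix c b).mulVec fun q => b q x :=
  funext fun k => hb.eq_sum (hc k) x

theorem sum_mul_conj_eq (hb : IsHarmonicONB d l b) {κ : Type*} [Fintype κ]
    [DecidableEq κ] (hκ : Fintype.card κ = harmDim d l)
    {c : κ → Sph d → ℂ} (hc : ∀ k, c k ∈ harmonicSpace d l)
    (horth : ∀ k k', ∫ x, c k x * conj (c k' x) ∂(nu d) = if k = k' then 1 else 0) (x : Sph d) :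
    ∑ k, c k x * conj (c k x) = ∑ q, b q x * conj (b q x) := by
  have h : star (fun k => c k x) ⬝ᵥ (fun k => c k x) =
      star (fun q => b q x) ⬝ᵥ (fun q => b q x) := by
    rw [hb.eq_coeffMatrix_mulVec hc x, Matrix.star_mulVec, ← Matrix.dotProduct_mulVec,
      Matrix.mulVec_mulVec, hb.conjTranspose_mul_coeffMatrix hκ hc horth, Matrix.one_mulVec]
  simpa [dotProduct, mul_comm] using h

/-- Moving the basis by an isometry yields another orthonormal basis, so `∑ |b q|²` takes the same
value at all points; its integral is the dimension. -/
theorem sum_mul_conj_mul_measure (hb : IsHarmonicONB d l b) (x : Sph d) :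
    (∑ q, b q x * conj (b q x)) * ((nu d).real Set.univ : ℂ) = harmDim d l := by
  have hconst (y : Sph d) : ∑ q, b q y * conj (b q y) = ∑ q, b q x * conj (b q x) := by
    obtain ⟨g, rfl⟩ := exists_isoSph_eq x y
    refine hb.sum_mul_conj_eq (c := fun q x => b q (isoSph g x)) (Fintype.card_fin _)
      (fun q => comp_isoSph_mem_harmonicSpace g (hb.mem q)) (fun q r => ?_) x
    rw [← hb.orthonormal q r]
    exact integral_isoSph g ((hb.continuous q).mul (Complex.continuous_conj.comp (hb.continuous r)))
  have h : ∫ y, ∑ q, b q y * conj (b q y) ∂(nu d) = harmDim d l := by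
    have hcont (q : Fin (harmDim d l)) : Continuous fun y => b q y * conj (b q y) :=
      (hb.continuous q).mul (Complex.continuous_conj.comp (hb.continuous q))
    rw [integral_finsetSum _ fun q _ => integrable_sph (hcont q)]
    simp [hb.orthonormal]
  simp only [hconst, integral_const, Complex.real_smul] at h
  rw [mul_comm, h]

theorem sum_norm_sq_mul_measure (hb : IsHarmonicONB d l b) (x : Sph d) :
    (∑ q, ‖b q x‖ ^ 2) * (nu d).real Set.univ = harmDim d l := by
  have h := hb.sum_mul_conj_mul_measure x
  simp only [Complex.mul_conj, Complex.normSq_eq_norm_sq] at h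
  exact_mod_cast h

theorem conj_eq_mulVec (hb : IsHarmonicONB d l b) (x : Sph d) :
    (fun q => conj (b q x)) =
      (coeffMatrix (fun q x => conj (b q x)) b).mulVec fun q => b q x :=
  hb.eq_coeffMatrix_mulVec (fun q => conj_mem_harmonicSpace (hb.mem q)) x

theorem orthonormal_conj (hb : IsHarmonicONB d l b) (q r : Fin (harmDim d l)) :
    ∫ x, conj (b q x) * conj (conj (b r x)) ∂(nu d) = if q = r then 1 else 0 := by
  have h := congrArg conj (hb.orthonormal q r)
  rw [← integral_conj] at h
  simpa [apply_ite conj] using h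

theorem conjTranspose_mul_coeffMatrix_conj (hb : IsHarmonicONB d l b) :
    (coeffMatrix (fun q x => conj (b q x)) b).conjTranspose *
      coeffMatrix (fun q x => conj (b q x)) b = 1 :=
  hb.conjTranspose_mul_coeffMatrix (Fintype.card_fin _)
    (fun q => conj_mem_harmonicSpace (hb.mem q)) hb.orthonormal_conj

theorem _root_.SphereDeconv.coeffMatrix_conj_transpose {d : ℕ} {ι : Type*} (b : ι → Sph d → ℂ) :
    (coeffMatrix (fun q x => conj (b q x)) b).transpose =
      coeffMatrix (fun q x => conj (b q x)) b := by
  ext q r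
  simp [coeffMatrix, mul_comm]

end IsHarmonicONB

/-! ### The rotational Fourier transform under change of basis and conjugation. -/

/-- The sesquilinear form `∫ g(u) ⟨f₂, f₁ ∘ u⟩ dμ(u)` whose matrix in a basis of spherical harmonics
is the rotational Fourier transform of `g`. -/
def rotPair {d : ℕ} (g : SO d → ℝ) (f₁ f₂ : Sph d → ℂ) : ℂ :=
  ∫ u, (g u : ℂ) * ∫ x, conj (f₁ (rot u x)) * f₂ x ∂(nu d) ∂(haarSO d)

instance {d : ℕ} : IsFiniteMeasure (haarSO d) := by
  unfold haarSO; infer_instance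

instance {d : ℕ} : SecondCountableTopology (SO d) :=
  haveI : SecondCountableTopology (Matrix (Fin (d + 1)) (Fin (d + 1)) ℝ) :=
    inferInstanceAs (SecondCountableTopology (Fin (d + 1) → Fin (d + 1) → ℝ))
  TopologicalSpace.Subtype.secondCountableTopology _

theorem continuous_integral_rot {d : ℕ} {f₁ f₂ : Sph d → ℂ} (h₁ : Continuous f₁)
    (h₂ : Continuous f₂) :
    Continuous fun u : SO d => ∫ x, conj (f₁ (rot u x)) * f₂ x ∂(nu d) := by
  have h : Continuous (fun p : SO d × Sph d => conj (f₁ (rot p.1 p.2)) * f₂ p.2) :=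
    (Complex.continuous_conj.comp (h₁.comp continuous_rot)).mul (h₂.comp continuous_snd)
  simpa using continuous_parametric_integral_of_continuous (μ := nu d)
    (f := fun (u : SO d) x => conj (f₁ (rot u x)) * f₂ x) h isCompact_univ

theorem integrable_mul_integral_rot {d : ℕ} {g : SO d → ℝ} (hg : Integrable g (haarSO d))
    {f₁ f₂ : Sph d → ℂ} (h₁ : Continuous f₁) (h₂ : Continuous f₂) :
    Integrable (fun u => (g u : ℂ) * ∫ x, conj (f₁ (rot u x)) * f₂ x ∂(nu d)) (haarSO d) := by
  have hc := continuous_integral_rot h₁ h₂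
  obtain ⟨C, hC⟩ := (isCompact_range hc).isBounded.exists_norm_le
  exact hg.ofReal.mul_bdd (c := C) hc.aestronglyMeasurable (.of_forall fun u => hC _ ⟨u, rfl⟩)

theorem continuous_rot_right {d : ℕ} (u : SO d) : Continuous (rot u) :=
  continuous_rot.comp (Continuous.prodMk_right u)

theorem rotPair_sum_sum {d : ℕ} {g : SO d → ℝ} (hg : Integrable g (haarSO d))
    {ι κ : Type*} [Fintype ι] [Fintype κ] {b : ι → Sph d → ℂ} {c : κ → Sph d → ℂ}
    (hb : ∀ i, Continuous (b i)) (hc : ∀ k, Continuous (c k)) (a : ι → ℂ) (a' : κ → ℂ) :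
    rotPair g (fun x => ∑ i, a i * b i x) (fun x => ∑ k, a' k * c k x) =
      ∑ i, ∑ k, conj (a i) * a' k * rotPair g (b i) (c k) := by
  have h (u : SO d) : (g u : ℂ) * ∫ x, conj (∑ i, a i * b i (rot u x)) *
      (∑ k, a' k * c k x) ∂(nu d) =
      ∑ i, ∑ k, conj (a i) * a' k *
        ((g u : ℂ) * ∫ x, conj (b i (rot u x)) * c k x ∂(nu d)) := by
    simp only [mul_comm (conj _) (Finset.sum _ _)]
    have h := integral_sum_mul_conj_sum (c := fun i x => b i (rot u x)) hc
      (fun i => (hb i).comp (continuous_rot_right u)) a' a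
    rw [h, Finset.sum_comm, Finset.mul_sum]
    refine Finset.sum_congr rfl fun i _ => ?_
    rw [Finset.mul_sum]
    refine Finset.sum_congr rfl fun k _ => ?_
    simp only [mul_comm (conj (b i _))]
    ring
  have hint (i : ι) (k : κ) : Integrable (fun u => conj (a i) * a' k *
      ((g u : ℂ) * ∫ x, conj (b i (rot u x)) * c k x ∂(nu d))) (haarSO d) :=
    (integrable_mul_integral_rot hg (hb i) (hc k)).const_mul _
  simp only [rotPair, h]
  rw [integral_finsetSum _ fun i _ => integrable_finsetSum _ fun k _ => hint i k]
  refine Finset.sum_congr rfl fun i _ => ?_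
  rw [integral_finsetSum _ fun k _ => hint i k]
  exact Finset.sum_congr rfl fun k _ => integral_const_mul _ _

theorem rotPair_conj_conj {d : ℕ} (g : SO d → ℝ) (f₁ f₂ : Sph d → ℂ) :
    rotPair g (fun x => conj (f₁ x)) (fun x => conj (f₂ x)) = conj (rotPair g f₁ f₂) := by
  simp only [rotPair, ← integral_conj, map_mul, Complex.conj_ofReal]

theorem IsHarmonicONB.rotPair_eq {d l : ℕ} {B : (l : ℕ) → Fin (harmDim d l) → Sph d → ℂ}
    (hB : IsHarmonicONB d l (B l)) {g : SO d → ℝ} (hg : Integrable g (haarSO d))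
    {κ : Type*} {c : κ → Sph d → ℂ} (hc : ∀ k, c k ∈ harmonicSpace d l) :
    (Matrix.of fun k k' => rotPair g (c k) (c k')) =
      (coeffMatrix c (B l)).map conj * rotFourier B g l * (coeffMatrix c (B l)).transpose := by
  ext k k'
  have h (k : κ) : c k = fun x => ∑ q, coeffMatrix c (B l) k q * B l q x :=
    funext fun x => hB.eq_sum (hc k) x
  rw [Matrix.of_apply, h k, h k', rotPair_sum_sum hg hB.continuous hB.continuous,
    Matrix.mul_apply, Finset.sum_comm]
  refine Finset.sum_congr rfl fun r _ => ?_
  rw [Matrix.mul_apply, Finset.sum_mul]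
  refine Finset.sum_congr rfl fun q _ => ?_
  simp only [Matrix.map_apply, Matrix.transpose_apply]
  rw [mul_right_comm]
  rfl

open Matrix in
/-- The rotational Fourier transform of a real function commutes with complex conjugation. -/
theorem IsHarmonicONB.rotFourier_map_conj {d l : ℕ} {B : (l : ℕ) → Fin (harmDim d l) → Sph d → ℂ}
    (hB : IsHarmonicONB d l (B l)) {g : SO d → ℝ} (hg : Integrable g (haarSO d)) :
    (rotFourier B g l).map conj =
      (coeffMatrix (fun q x => conj (B l q x)) (B l))ᴴ * rotFourier B g l *
        coeffMatrix (fun q x => conj (B l q x)) (B l) := by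
  have h := hB.rotPair_eq hg (c := fun q x => conj (B l q x))
    fun q => conj_mem_harmonicSpace (hB.mem q)
  simp only [rotPair_conj_conj] at h
  rw [coeffMatrix_conj_transpose] at h
  -- For a symmetric matrix, entrywise conjugation is the conjugate transpose.
  have h2 : (coeffMatrix (fun q x => conj (B l q x)) (B l)).map conj =
      (coeffMatrix (fun q x => conj (B l q x)) (B l))ᴴ := by
    conv_lhs => rw [← coeffMatrix_conj_transpose]
    rfl
  rw [← h2, ← h]
  rfl

/-! ### The kernel: reality and `L²` norm. -/

/-- The degree `l` part of the deconvolution kernel. -/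
def kernelPart {d : ℕ} (B : (l : ℕ) → Fin (harmDim d l) → Sph d → ℂ) (g : SO d → ℝ) (l : ℕ)
    (x z : Sph d) : ℂ :=
  ∑ q, (∑ r, (rotFourier B g l)⁻¹ q r * conj (B l r z)) * B l q x

-- With `A = φ⁻¹`, the part is `B(x)ᵀ A conj B(z)`. Inserting `conj B = M B` and `conj A = Mᴴ A M`
-- into its conjugate gives `B(x)ᵀ M Mᴴ A M B(z)`, which is the original expression because `M Mᴴ =
-- 1`.
open Matrix in
theorem IsHarmonicONB.conj_kernelPart {d l : ℕ} {B : (l : ℕ) → Fin (harmDim d l) → Sph d → ℂ}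
    (hB : IsHarmonicONB d l (B l)) {g : SO d → ℝ} (hg : Integrable g (haarSO d))
    (x z : Sph d) : conj (kernelPart B g l x z) = kernelPart B g l x z := by
  set M := coeffMatrix (fun q x => conj (B l q x)) (B l) with hM
  set A := (rotFourier B g l)⁻¹ with hA
  have hMM : Mᴴ * M = 1 := hB.conjTranspose_mul_coeffMatrix_conj
  have hMM' : M * Mᴴ = 1 := mul_eq_one_comm.1 hMM
  have hMT : Mᵀ = M := coeffMatrix_conj_transpose _
  have hAconj : A.map conj = Mᴴ * A * M := by
    have h1 : A.map conj = ((rotFourier B g l).map conj)⁻¹ := by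
      rw [hA]
      have := Matrix.conjTranspose_nonsing_inv (rotFourier B g l)ᵀ
      rw [← Matrix.transpose_nonsing_inv] at this
      exact this
    rw [h1, hB.rotFourier_map_conj hg, ← hM, Matrix.mul_inv_rev, Matrix.mul_inv_rev,
      Matrix.inv_eq_left_inv hMM, Matrix.inv_eq_left_inv hMM', Matrix.mul_assoc]
  have hK (x z : Sph d) : kernelPart B g l x z =
      (fun q => B l q x) ⬝ᵥ A *ᵥ (fun r => conj (B l r z)) := by
    simp only [kernelPart, dotProduct, mulVec, mul_comm (B l _ x)]
    rfl
  have hKc : conj (kernelPart B g l x z) =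
      (fun q => conj (B l q x)) ⬝ᵥ (A.map conj) *ᵥ (fun r => B l r z) := by
    rw [hK]
    simp [dotProduct, mulVec, map_sum]
  have hdot (v w : Fin (harmDim d l) → ℂ) : (M *ᵥ v) ⬝ᵥ w = v ⬝ᵥ M *ᵥ w := by
    conv_lhs => rw [← hMT, Matrix.mulVec_transpose, ← Matrix.dotProduct_mulVec]
  rw [hKc, hK, hB.conj_eq_mulVec x, hB.conj_eq_mulVec z, hAconj, ← hM, hdot,
    Matrix.mulVec_mulVec, ← Matrix.mul_assoc, ← Matrix.mul_assoc, hMM', Matrix.one_mul,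
    Matrix.mulVec_mulVec]

theorem kernelK_eq_sum {d : ℕ} (B : (l : ℕ) → Fin (harmDim d l) → Sph d → ℂ) (g : SO d → ℝ)
    (T : ℝ) (x z : Sph d) :
    kernelK B g T x z = ∑ l ∈ Finset.range (⌊T⌋₊ + 1), kernelPart B g l x z :=
  rfl

/-- The coefficients of the degree `l` part of the kernel as a function of its second variable. -/
def kernelCoeff {d : ℕ} (B : (l : ℕ) → Fin (harmDim d l) → Sph d → ℂ) (g : SO d → ℝ) (l : ℕ)
    (x : Sph d) (r : Fin (harmDim d l)) : ℂ :=
  ∑ q, (rotFourier B g l)⁻¹ q r * B l q x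

theorem kernelPart_eq {d : ℕ} (B : (l : ℕ) → Fin (harmDim d l) → Sph d → ℂ) (g : SO d → ℝ) (l : ℕ)
    (x z : Sph d) :
    kernelPart B g l x z = ∑ r, kernelCoeff B g l x r * conj (B l r z) := by
  simp only [kernelPart, kernelCoeff, Finset.sum_mul]
  rw [Finset.sum_comm]
  exact Finset.sum_congr rfl fun r _ => Finset.sum_congr rfl fun q _ => by ring

theorem kernelPart_mem {d : ℕ} {B : (l : ℕ) → Fin (harmDim d l) → Sph d → ℂ}
    (hB : ∀ l, IsHarmonicONB d l (B l)) (g : SO d → ℝ) (l : ℕ) (x : Sph d) :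
    kernelPart B g l x ∈ harmonicSpace d l := by
  have h : kernelPart B g l x = ∑ r, kernelCoeff B g l x r • fun z => conj (B l r z) := by
    ext z
    simp [kernelPart_eq, Finset.sum_apply]
  rw [h]
  exact Submodule.sum_mem _ fun r _ =>
    Submodule.smul_mem _ _ (conj_mem_harmonicSpace ((hB l).mem r))

theorem continuous_kernelK {d : ℕ} {B : (l : ℕ) → Fin (harmDim d l) → Sph d → ℂ}
    (hB : ∀ l, IsHarmonicONB d l (B l)) (g : SO d → ℝ) (T : ℝ) (x : Sph d) :
    Continuous (kernelK B g T x) := by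
  have h : kernelK B g T x = fun z => ∑ l ∈ Finset.range (⌊T⌋₊ + 1), kernelPart B g l x z := rfl
  rw [h]
  exact continuous_finsetSum _ fun l _ => continuous_of_mem_harmonicSpace (kernelPart_mem hB g l x)

theorem kernelK_im {d : ℕ} {B : (l : ℕ) → Fin (harmDim d l) → Sph d → ℂ}
    (hB : ∀ l, IsHarmonicONB d l (B l)) {g : SO d → ℝ} (hg : Integrable g (haarSO d))
    (T : ℝ) (x z : Sph d) : (kernelK B g T x z).im = 0 := by
  rw [← Complex.conj_eq_iff_im, kernelK_eq_sum, map_sum]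
  exact Finset.sum_congr rfl fun l _ => (hB l).conj_kernelPart hg x z

theorem integral_kernelPart_mul_conj {d : ℕ} {B : (l : ℕ) → Fin (harmDim d l) → Sph d → ℂ}
    (hB : ∀ l, IsHarmonicONB d l (B l)) (hd : 1 ≤ d) (g : SO d → ℝ) (l m : ℕ) (x : Sph d) :
    ∫ z, kernelPart B g l x z * conj (kernelPart B g m x z) ∂(nu d) =
      if l = m then ((∑ r, ‖kernelCoeff B g l x r‖ ^ 2 : ℝ) : ℂ) else 0 := by
  split_ifs with h
  · subst h
    have hcont (r : Fin (harmDim d l)) : Continuous fun z => conj (B l r z) :=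
      Complex.continuous_conj.comp ((hB l).continuous r)
    simp only [kernelPart_eq]
    rw [integral_sum_mul_conj_sum hcont hcont]
    simp only [(hB l).orthonormal_conj]
    simp [Complex.mul_conj, Complex.normSq_eq_norm_sq]
  · exact integral_mul_harmonic_of_ne hd h (kernelPart_mem hB g l x)
      (conj_mem_harmonicSpace (kernelPart_mem hB g m x))

theorem integral_kernelK_re_sq {d : ℕ} {B : (l : ℕ) → Fin (harmDim d l) → Sph d → ℂ}
    (hB : ∀ l, IsHarmonicONB d l (B l)) (hd : 1 ≤ d) {g : SO d → ℝ}
    (hg : Integrable g (haarSO d)) (T : ℝ) (x : Sph d) :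
    ∫ z, (kernelK B g T x z).re ^ 2 ∂(nu d) =
      ∑ l ∈ Finset.range (⌊T⌋₊ + 1), ∑ r, ‖kernelCoeff B g l x r‖ ^ 2 := by
  have hint (l m : ℕ) : Continuous fun z => kernelPart B g l x z * conj (kernelPart B g m x z) :=
    (continuous_of_mem_harmonicSpace (kernelPart_mem hB g l x)).mul
      (continuous_of_mem_harmonicSpace (conj_mem_harmonicSpace (kernelPart_mem hB g m x)))
  -- As the kernel is real, the square of its real part is `K * conj K`, whose cross terms between
  -- degrees integrate to zero.
  have h (z : Sph d) : (((kernelK B g T x z).re ^ 2 : ℝ) : ℂ) =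
      ∑ l ∈ Finset.range (⌊T⌋₊ + 1), ∑ m ∈ Finset.range (⌊T⌋₊ + 1),
        kernelPart B g l x z * conj (kernelPart B g m x z) := by
    rw [← Finset.sum_mul_sum, ← map_sum, ← kernelK_eq_sum, Complex.mul_conj,
      Complex.normSq_apply, kernelK_im hB hg]
    simp [sq]
  apply Complex.ofReal_injective
  rw [← integral_complex_ofReal]
  simp only [h]
  rw [integral_finsetSum _ fun l _ =>
    integrable_sph (continuous_finsetSum _ fun m _ => hint l m), Complex.ofReal_sum]
  refine Finset.sum_congr rfl fun l hl => ?_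
  rw [integral_finsetSum _ fun m _ => integrable_sph (hint l m)]
  simp only [integral_kernelPart_mul_conj hB hd]
  rw [Finset.sum_ite_eq, if_pos hl]

/-! ### Lower bound for the `L²` norm when `φ φᴴ` is scalar. -/

open Matrix in
theorem sum_norm_sq_mulVec_of_conjTranspose_mul {n : Type*} [Fintype n] [DecidableEq n]
    {A : Matrix n n ℂ} {c : ℝ} (hA : Aᴴ * A = (c : ℂ) • 1) (v : n → ℂ) :
    ∑ i, ‖(A *ᵥ v) i‖ ^ 2 = c * ∑ i, ‖v i‖ ^ 2 := by
  have h : star (A *ᵥ v) ⬝ᵥ (A *ᵥ v) = (c : ℂ) * (star v ⬝ᵥ v) := by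
    rw [Matrix.star_mulVec, ← Matrix.dotProduct_mulVec, Matrix.mulVec_mulVec, hA,
      Matrix.smul_mulVec, Matrix.one_mulVec, dotProduct_smul, smul_eq_mul]
  have h2 (w : n → ℂ) : star w ⬝ᵥ w = ((∑ i, ‖w i‖ ^ 2 : ℝ) : ℂ) := by
    simp [dotProduct, mul_comm (conj (w _)), Complex.mul_conj, Complex.normSq_eq_norm_sq]
  rw [h2, h2] at h
  exact_mod_cast h

open Matrix in
theorem norm_toEuclideanCLM_sq_le {n : Type*} [Fintype n] [DecidableEq n]
    {A : Matrix n n ℂ} {c : ℝ} (hc : 0 ≤ c) (hA : Aᴴ * A = (c : ℂ) • 1) :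
    ‖Matrix.toEuclideanCLM (n := n) (𝕜 := ℂ) A‖ ^ 2 ≤ c := by
  rw [← Real.le_sqrt (norm_nonneg _) hc]
  refine ContinuousLinearMap.opNorm_le_bound _ (Real.sqrt_nonneg _) fun v => ?_
  rw [← sq_le_sq₀ (norm_nonneg _) (by positivity), mul_pow, Real.sq_sqrt hc,
    EuclideanSpace.norm_sq_eq, EuclideanSpace.norm_sq_eq]
  exact (sum_norm_sq_mulVec_of_conjTranspose_mul hA v.ofLp).le

-- Here `φ⁻¹` is `c^(-1/2)` times a unitary matrix, and so is its transpose, the matrix acting on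
-- `B^l(x)`. It therefore stretches every vector by the same factor, and the squared operator norm
-- is at most `c⁻¹`.
open Matrix in
theorem invOpNorm_sq_mul_le {d l : ℕ} (B : (l : ℕ) → Fin (harmDim d l) → Sph d → ℂ)
    (g : SO d → ℝ) {c : ℝ} (hc : 0 < c)
    (h : rotFourier B g l * (rotFourier B g l)ᴴ = (c : ℂ) • 1) (x : Sph d) :
    invOpNorm B g l ^ 2 * ∑ q, ‖B l q x‖ ^ 2 ≤ ∑ r, ‖kernelCoeff B g l x r‖ ^ 2 := by
  set φ := rotFourier B g l
  have hc' : (c : ℂ) ≠ 0 := by exact_mod_cast hc.ne'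
  have hinv : φ⁻¹ = (c : ℂ)⁻¹ • φᴴ := by
    refine Matrix.inv_eq_right_inv ?_
    rw [Matrix.mul_smul, h, smul_smul, inv_mul_cancel₀ hc', one_smul]
  have h' : φᴴ * φ = (c : ℂ) • 1 := by
    have h1 : φ * ((c : ℂ)⁻¹ • φᴴ) = 1 := by
      rw [Matrix.mul_smul, h, smul_smul, inv_mul_cancel₀ hc', one_smul]
    have h2 := mul_eq_one_comm.1 h1
    rw [← h2, Matrix.smul_mul, smul_smul, mul_inv_cancel₀ hc', one_smul]
  have hA : (φ⁻¹)ᴴ * φ⁻¹ = ((c⁻¹ : ℝ) : ℂ) • 1 := by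
    rw [hinv, Matrix.conjTranspose_smul, Matrix.conjTranspose_conjTranspose, Matrix.smul_mul,
      Matrix.mul_smul, h, smul_smul, smul_smul]
    congr 1
    simp [hc']
  have hAT : ((φ⁻¹)ᵀ)ᴴ * (φ⁻¹)ᵀ = ((c⁻¹ : ℝ) : ℂ) • 1 := by
    have h3 : φ⁻¹ * (φ⁻¹)ᴴ = ((c⁻¹ : ℝ) : ℂ) • 1 := by
      rw [hinv, Matrix.conjTranspose_smul, Matrix.conjTranspose_conjTranspose, Matrix.smul_mul,
        Matrix.mul_smul, h', smul_smul, smul_smul]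
      congr 1
      simp [hc']
    have h4 := congrArg Matrix.transpose h3
    rw [Matrix.transpose_mul, Matrix.transpose_smul, Matrix.transpose_one] at h4
    exact h4
  have hk : kernelCoeff B g l x = (φ⁻¹)ᵀ *ᵥ fun q => B l q x := rfl
  rw [hk, sum_norm_sq_mulVec_of_conjTranspose_mul hAT]
  gcongr
  exact norm_toEuclideanCLM_sq_le (inv_nonneg.2 hc.le) hA

open Matrix in
theorem le_integral_kernelK_re_sq {d : ℕ} {B : (l : ℕ) → Fin (harmDim d l) → Sph d → ℂ}
    (hB : ∀ l, IsHarmonicONB d l (B l)) (hd : 1 ≤ d) {g : SO d → ℝ}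
    (hg : Integrable g (haarSO d))
    (hG : ∀ l, ∃ c : ℝ, 0 < c ∧ rotFourier B g l * (rotFourier B g l)ᴴ = (c : ℂ) • 1)
    (T : ℝ) (x : Sph d) :
    (∑ l ∈ Finset.range (⌊T⌋₊ + 1), invOpNorm B g l ^ 2 * harmDim d l) ≤
      (nu d).real Set.univ * ∫ z, (kernelK B g T x z).re ^ 2 ∂(nu d) := by
  rw [integral_kernelK_re_sq hB hd hg, Finset.mul_sum]
  refine Finset.sum_le_sum fun l _ => ?_
  obtain ⟨c, hc, h⟩ := hG l
  rw [← (hB l).sum_norm_sq_mul_measure x, ← mul_assoc, mul_comm]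
  gcongr
  exact invOpNorm_sq_mul_le B g hc h x

/-! ### The circle: exponentials diagonalize the rotational Fourier transform. -/

/-- The point `x₀ + i x₁` of the complex plane. -/
def circleCoord (x : Sph 1) : ℂ := (x.1 0 : ℝ) + Complex.I * (x.1 1 : ℝ)

theorem circleCoord_mul_conj (x : Sph 1) : circleCoord x * conj (circleCoord x) = 1 := by
  have h : ‖x.1‖ ^ 2 = 1 := by simp
  rw [EuclideanSpace.real_norm_sq_eq, Fin.sum_univ_two] at h
  have h' : ((x.1 0 : ℝ) : ℂ) ^ 2 + ((x.1 1 : ℝ) : ℂ) ^ 2 = 1 := by exact_mod_cast h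
  simp only [circleCoord, map_add, map_mul, Complex.conj_ofReal, Complex.conj_I]
  linear_combination h' - ((x.1 1 : ℝ) : ℂ) ^ 2 * Complex.I_sq

-- A power of `x₀ + i x₁` is holomorphic, hence harmonic: its two second derivatives differ by the
-- factor `i² = -1`.
open MvPolynomial in
theorem circleCoord_pow_mem (n : ℕ) : (fun x => circleCoord x ^ n) ∈ harmonicSpace 1 n := by
  set Z : MvPolynomial (Fin (1 + 1)) ℂ := X 0 + C Complex.I * X 1 with hZ
  refine ⟨Z ^ n, ⟨?_, ?_⟩, ?_⟩
  · have h : Z.IsHomogeneous 1 :=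
      (isHomogeneous_X _ _).add ((isHomogeneous_X _ _).C_mul _)
    simpa using h.pow n
  · change polyLaplacian 1 _ = 0
    have h0 : pderiv 0 Z = 1 := by simp [hZ, pderiv_X]
    have h1 : pderiv 1 Z = C Complex.I := by simp [hZ, pderiv_X]
    have hI : (C Complex.I : MvPolynomial (Fin (1 + 1)) ℂ) * C Complex.I = -1 := by
      rw [← C_mul, Complex.I_mul_I, C_neg, C_1]
    rw [polyLaplacian_apply, Fin.sum_univ_two]
    have e0 : (pderiv 0) ((pderiv 0) (Z ^ n)) = n * ((n - 1 : ℕ) * Z ^ (n - 1 - 1)) := by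
      simp [h0]
    have e1 : (pderiv 1) ((pderiv 1) (Z ^ n)) = - (n * ((n - 1 : ℕ) * Z ^ (n - 1 - 1))) := by
      simp only [pderiv_pow, h1, pderiv_mul, pderiv_C, ← C_eq_coe_nat]
      linear_combination C (n : ℂ) * (C ((n - 1 : ℕ) : ℂ) * Z ^ (n - 1 - 1)) * hI
    rw [e0, e1, add_neg_cancel]
  · ext x
    simp [hZ, restrictSph_apply, circleCoord]

theorem SO_one_entries (u : SO 1) : u.1 1 1 = u.1 0 0 ∧ u.1 0 1 = - u.1 1 0 := by
  have hu : u.1 * u.1.transpose = 1 :=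
    (Matrix.mem_orthogonalGroup_iff (Fin (1 + 1)) ℝ).1
      (Matrix.mem_specialOrthogonalGroup_iff.1 u.2).1
  have hdet := (Matrix.mem_specialOrthogonalGroup_iff.1 u.2).2
  rw [Matrix.det_fin_two] at hdet
  have h00 := congrFun (congrFun hu 0) 0
  have h01 := congrFun (congrFun hu 0) 1
  simp [Matrix.mul_apply, Fin.sum_univ_two] at h00 h01
  constructor
  · linear_combination (- u.1 1 1) * h00 + u.1 0 0 * hdet + u.1 0 1 * h01
  · linear_combination (- u.1 0 1) * hdet - u.1 1 0 * h00 + u.1 0 0 * h01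

theorem circleCoord_rot (u : SO 1) (x : Sph 1) :
    circleCoord (rot u x) = ((u.1 0 0 : ℝ) + Complex.I * (u.1 1 0 : ℝ)) * circleCoord x := by
  obtain ⟨h1, h2⟩ := SO_one_entries u
  have hr (i : Fin (1 + 1)) : (rot u x).1 i = u.1 i 0 * x.1 0 + u.1 i 1 * x.1 1 := by
    fin_cases i <;> simp [rot, Matrix.toLpLin_apply]
  simp only [circleCoord, hr, h1, h2]
  push_cast
  linear_combination (- ((u.1 1 0 : ℝ) : ℂ) * ((x.1 1 : ℝ) : ℂ)) * Complex.I_sq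

/-- The normalized exponentials of degrees `l` and `-l` on the circle. -/
def circleBasis (l : ℕ) (k : Fin 2) (x : Sph 1) : ℂ :=
  if k = 0 then ((√((nu 1).real Set.univ))⁻¹ : ℝ) * circleCoord x ^ l
  else conj (((√((nu 1).real Set.univ))⁻¹ : ℝ) * circleCoord x ^ l)

theorem circleBasis_one (l : ℕ) (x : Sph 1) :
    circleBasis l 1 x = conj (circleBasis l 0 x) := by
  simp [circleBasis]

theorem circleBasis_mem (l : ℕ) (k : Fin 2) : circleBasis l k ∈ harmonicSpace 1 l := by
  have h0 : circleBasis l 0 ∈ harmonicSpace 1 l :=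
    Submodule.smul_mem _ (((√((nu 1).real Set.univ))⁻¹ : ℝ) : ℂ) (circleCoord_pow_mem l)
  fin_cases k
  · exact h0
  · have h1 : circleBasis l 1 = fun x => conj (circleBasis l 0 x) := funext (circleBasis_one l)
    exact h1 ▸ conj_mem_harmonicSpace h0

theorem measureReal_nu_pos (d : ℕ) : 0 < (nu d).real Set.univ := by
  rw [measureReal_def, ENNReal.toReal_pos_iff, pos_iff_ne_zero, Ne, Measure.measure_univ_eq_zero]
  exact ⟨Measure.toSphere_ne_zero _, measure_lt_top _ _⟩

theorem circleBasis_orthonormal {l : ℕ} (hl : l ≠ 0) (k k' : Fin 2) :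
    ∫ x, circleBasis l k x * conj (circleBasis l k' x) ∂(nu 1) = if k = k' then 1 else 0 := by
  have h00 (x : Sph 1) : circleBasis l 0 x * conj (circleBasis l 0 x) =
      (((nu 1).real Set.univ)⁻¹ : ℝ) := by
    have hs : √((nu 1).real Set.univ) * √((nu 1).real Set.univ) = (nu 1).real Set.univ :=
      Real.mul_self_sqrt (measureReal_nu_pos 1).le
    simp only [circleBasis, if_true, map_mul, map_pow, Complex.conj_ofReal]
    rw [mul_mul_mul_comm, ← mul_pow, circleCoord_mul_conj, one_pow, mul_one, ← Complex.ofReal_mul,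
      ← mul_inv, hs]
  have hi : ∫ x, circleBasis l 0 x * conj (circleBasis l 0 x) ∂(nu 1) = 1 := by
    simp only [h00, integral_const, Complex.real_smul, ← Complex.ofReal_mul]
    rw [mul_inv_cancel₀ (measureReal_nu_pos 1).ne', Complex.ofReal_one]
  -- The integrand is a multiple of a harmonic of degree `2l`, orthogonal to the constants because
  -- `l ≠ 0`.
  have hz : ∫ x, circleBasis l 0 x * circleBasis l 0 x ∂(nu 1) = 0 := by
    have h := integral_mul_harmonic_of_ne (d := 1) le_rfl (l := l + l) (m := 0) (by omega)
      (circleCoord_pow_mem (l + l)) (circleCoord_pow_mem 0)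
    simp only [pow_zero, mul_one] at h
    simp only [circleBasis, if_true, mul_mul_mul_comm _ (circleCoord _ ^ l), ← pow_add]
    rw [integral_const_mul, h, mul_zero]
  have hz' : ∫ x, conj (circleBasis l 0 x) * conj (circleBasis l 0 x) ∂(nu 1) = 0 := by
    simp only [← map_mul]
    rw [integral_conj, hz, map_zero]
  fin_cases k <;> fin_cases k' <;> simp [circleBasis_one, hi, hz, hz']
  simpa only [mul_comm] using hi

/-- A rotation multiplies an exponential by a scalar, so the off-diagonal entries inherit the
orthogonality of the basis. The diagonal entries are conjugate because `g` is real. -/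
theorem rotPair_circleBasis (g : SO 1 → ℝ) {l : ℕ} (hl : l ≠ 0) :
    (Matrix.of fun k k' => rotPair g (circleBasis l k) (circleBasis l k')) =
      Matrix.diagonal ![rotPair g (circleBasis l 0) (circleBasis l 0),
        conj (rotPair g (circleBasis l 0) (circleBasis l 0))] := by
  have h1 : circleBasis l 1 = fun x => conj (circleBasis l 0 x) := funext (circleBasis_one l)
  have h01 : rotPair g (circleBasis l 0) (circleBasis l 1) = 0 := by
    have h (u : SO 1) : ∫ x, conj (circleBasis l 0 (rot u x)) * circleBasis l 1 x ∂(nu 1) = 0 := by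
      have h2 (x : Sph 1) : conj (circleBasis l 0 (rot u x)) * circleBasis l 1 x =
          conj (((u.1 0 0 : ℝ) + Complex.I * (u.1 1 0 : ℝ)) ^ l) *
            (circleBasis l 1 x * conj (circleBasis l 0 x)) := by
        simp only [circleBasis, circleCoord_rot, mul_pow, map_mul, if_true]
        ring
      simp only [h2]
      rw [integral_const_mul, circleBasis_orthonormal hl]
      simp
    simp [rotPair, h]
  ext k k'
  fin_cases k <;> fin_cases k'
  · simp
  · simpa using h01
  · have h := rotPair_conj_conj g (circleBasis l 0) (circleBasis l 1)
    rw [h01, map_zero, ← h1] at h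
    have h3 : (fun x => conj (circleBasis l 1 x)) = circleBasis l 0 :=
      funext fun x => by simp [circleBasis_one]
    rw [h3] at h
    simpa using h
  · have h := rotPair_conj_conj g (circleBasis l 0) (circleBasis l 0)
    rw [← h1] at h
    simpa using h

/-! ### Dimensions, and scalarity of `φ φᴴ`. -/

open Matrix in
theorem exists_pos_of_mul_conjTranspose {n : Type*} [Fintype n] [DecidableEq n] [Nonempty n]
    {A : Matrix n n ℂ} (hA : IsUnit A) {a : ℂ} (h : A * Aᴴ = (Complex.normSq a : ℂ) • 1) :
    ∃ c : ℝ, 0 < c ∧ A * Aᴴ = (c : ℂ) • 1 := by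
  refine ⟨_, (Complex.normSq_nonneg a).lt_of_ne fun h0 => ?_, h⟩
  rw [← h0, Complex.ofReal_zero, zero_smul] at h
  have h1 : Aᴴ = 0 := hA.mul_right_eq_zero.1 h
  rw [Matrix.conjTranspose_eq_zero] at h1
  exact not_isUnit_zero (h1 ▸ hA)

theorem nonempty_fin_harmDim_zero (d : ℕ) : Nonempty (Fin (harmDim d 0)) :=
  ⟨⟨0, by simp [harmDim]⟩⟩

theorem harmDim_one {l : ℕ} (hl : l ≠ 0) : harmDim 1 l = 2 := by
  obtain ⟨m, rfl⟩ := Nat.exists_eq_succ_of_ne_zero hl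
  have h : 2 * m.succ + 1 - 1 = 2 * (m + 1) := by omega
  have h2 : m.succ + 1 - 2 = m := by omega
  rw [harmDim, if_neg hl, h, h2]
  simp only [Nat.sub_self, Nat.factorial_zero, mul_one, Nat.succ_eq_add_one, Nat.factorial_succ]
  rw [mul_assoc]
  exact Nat.mul_div_cancel _ (by positivity)

theorem harmDim_two (l : ℕ) : harmDim 2 l = 2 * l + 1 := by
  rcases eq_or_ne l 0 with rfl | hl
  · simp [harmDim]
  · rw [harmDim, if_neg hl]
    simp only [Nat.add_sub_cancel, Nat.add_one_sub_one]
    simpa using Nat.mul_div_cancel (2 * l + 1) (Nat.factorial_pos l)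

theorem pow_le_harmDim {d l : ℕ} (hd : d = 1 ∨ d = 2) : l ^ (d - 1) ≤ harmDim d l := by
  rcases hd with rfl | rfl
  · rcases eq_or_ne l 0 with rfl | hl
    · simp [harmDim]
    · simp [harmDim_one hl]
  · rw [harmDim_two]
    simp
    omega

theorem harmDim_pos {d l : ℕ} (hd : d = 1 ∨ d = 2) : 0 < harmDim d l := by
  rcases hd with rfl | rfl
  · rcases eq_or_ne l 0 with rfl | hl
    · simp [harmDim]
    · simp [harmDim_one hl]
  · simp [harmDim_two]

open Matrix in
theorem exists_rotFourier_mul_conjTranspose_zero {d : ℕ}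
    (B : (l : ℕ) → Fin (harmDim d l) → Sph d → ℂ) (g : SO d → ℝ)
    (hinv : IsUnit (rotFourier B g 0)) :
    ∃ c : ℝ, 0 < c ∧ rotFourier B g 0 * (rotFourier B g 0)ᴴ = (c : ℂ) • 1 := by
  have := nonempty_fin_harmDim_zero d
  have : Subsingleton (Fin (harmDim d 0)) :=
    Fin.subsingleton_iff_le_one.2 (by simp [harmDim])
  let i := Classical.arbitrary (Fin (harmDim d 0))
  refine exists_pos_of_mul_conjTranspose hinv (a := rotFourier B g 0 i i) ?_
  ext q r
  rw [Subsingleton.elim q i, Subsingleton.elim r i, Matrix.mul_apply, Fintype.sum_subsingleton _ i]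
  simp [Complex.mul_conj]

-- For `l ≠ 0`, `φ` is unitarily similar to `diag(a, conj a)`, so `φ φᴴ = |a|²`; invertibility
-- excludes `a = 0`. Degree `0` is separate, since there the two exponentials coincide.
open Matrix in
theorem exists_rotFourier_mul_conjTranspose_one {B : (l : ℕ) → Fin (harmDim 1 l) → Sph 1 → ℂ}
    (hB : ∀ l, IsHarmonicONB 1 l (B l)) {g : SO 1 → ℝ} (hg : Integrable g (haarSO 1)) (l : ℕ)
    (hinv : IsUnit (rotFourier B g l)) :
    ∃ c : ℝ, 0 < c ∧ rotFourier B g l * (rotFourier B g l)ᴴ = (c : ℂ) • 1 := by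
  rcases eq_or_ne l 0 with rfl | hl
  · exact exists_rotFourier_mul_conjTranspose_zero B g hinv
  have : Nonempty (Fin (harmDim 1 l)) := ⟨⟨0, harmDim_pos (.inl rfl)⟩⟩
  refine exists_pos_of_mul_conjTranspose hinv
    (a := rotPair g (circleBasis l 0) (circleBasis l 0)) ?_
  set a := rotPair g (circleBasis l 0) (circleBasis l 0) with ha
  set φ := rotFourier B g l with hφ
  set W := coeffMatrix (circleBasis l) (B l) with hW
  have hWW : Wᴴ * W = 1 := (hB l).conjTranspose_mul_coeffMatrix (by simp [harmDim_one hl])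
    (circleBasis_mem l) (circleBasis_orthonormal hl)
  have hWW' : W * Wᴴ = 1 := (hB l).coeffMatrix_mul_conjTranspose
    (circleBasis_mem l) (circleBasis_orthonormal hl)
  have hV : Wᵀ * Wᵀᴴ = 1 := by
    have h := congrArg Matrix.transpose hWW
    rwa [Matrix.transpose_mul, Matrix.transpose_one] at h
  have hV' : Wᵀᴴ * Wᵀ = 1 := by
    have h := congrArg Matrix.transpose hWW'
    rwa [Matrix.transpose_mul, Matrix.transpose_one] at h
  have hΛ : Matrix.diagonal ![a, conj a] = Wᵀᴴ * φ * Wᵀ := by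
    rw [← rotPair_circleBasis g hl]
    exact (hB l).rotPair_eq hg (circleBasis_mem l)
  have hΛΛ : Matrix.diagonal ![a, conj a] * (Matrix.diagonal ![a, conj a])ᴴ =
      (Complex.normSq a : ℂ) • 1 := by
    ext i j
    fin_cases i <;> fin_cases j <;>
      simp [Matrix.diagonal_conjTranspose, Complex.mul_conj, mul_comm (conj a)]
  have hφ' : φ = Wᵀ * Matrix.diagonal ![a, conj a] * Wᵀᴴ := by
    rw [hΛ, ← Matrix.mul_assoc, ← Matrix.mul_assoc, hV, Matrix.one_mul, Matrix.mul_assoc, hV,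
      Matrix.mul_one]
  calc φ * φᴴ = Wᵀ * (Matrix.diagonal ![a, conj a] * (Wᵀᴴ * Wᵀ) *
        (Matrix.diagonal ![a, conj a])ᴴ) * Wᵀᴴ := by
        rw [hφ', Matrix.conjTranspose_mul, Matrix.conjTranspose_mul,
          Matrix.conjTranspose_conjTranspose]
        simp only [Matrix.mul_assoc]
    _ = (Complex.normSq a : ℂ) • 1 := by
        rw [hV', Matrix.mul_one, hΛΛ, Matrix.mul_smul, Matrix.mul_one, Matrix.smul_mul, hV]

open Matrix in
theorem exists_rotFourier_mul_conjTranspose_of_eq_smul {d l : ℕ}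
    {B : (l : ℕ) → Fin (harmDim d l) → Sph d → ℂ} {g : SO d → ℝ} {s : ℝ} (hs : s ≠ 0)
    (h : rotFourier B g l = (s : ℂ) • 1) :
    ∃ c : ℝ, 0 < c ∧ rotFourier B g l * (rotFourier B g l)ᴴ = (c : ℂ) • 1 := by
  refine ⟨s ^ 2, by positivity, ?_⟩
  rw [h, Matrix.conjTranspose_smul, Matrix.conjTranspose_one, Matrix.smul_mul, Matrix.mul_smul,
    Matrix.mul_one, smul_smul]
  congr 1
  simp [sq]

/-! ### The law of the rotated vector. -/

theorem measurePreserving_rot {d : ℕ} (u : SO d) : MeasurePreserving (rot u) (nu d) (nu d) := by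
  obtain ⟨g, hg⟩ := exists_isoSph_eq_rot u
  rw [funext hg]
  exact measurePreserving_isoSph g

theorem measurable_rot {d : ℕ} : Measurable fun p : SO d × Sph d => rot p.1 p.2 :=
  continuous_rot.measurable

/-- The law of the rotated vector dominates a multiple of the surface measure. -/
theorem smul_nu_le_map_rot {Ω : Type*} [MeasurableSpace Ω] {P : Measure Ω} [IsProbabilityMeasure P]
    {d : ℕ} {X : Ω → Sph d} {U : Ω → SO d} (hX : Measurable X) (hU : Measurable U)
    (hUX : IndepFun U X P) {fX : Sph d → ℝ}
    (hfX : P.map X = (nu d).withDensity fun x => ENNReal.ofReal (fX x))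
    {c : ℝ} (hc : ∀ x, c ≤ fX x) :
    ENNReal.ofReal c • nu d ≤ P.map fun ω => rot (U ω) (X ω) := by
  have hle : ENNReal.ofReal c • nu d ≤ P.map X := by
    rw [hfX, ← withDensity_const]
    exact withDensity_mono (.of_forall fun x => ENNReal.ofReal_le_ofReal (hc x))
  have hprob : IsProbabilityMeasure (P.map U) := Measure.isProbabilityMeasure_map hU.aemeasurable
  have hprobX : IsProbabilityMeasure (P.map X) := Measure.isProbabilityMeasure_map hX.aemeasurable
  refine Measure.le_iff.2 fun s hs => ?_
  have hmap : P.map (fun ω => rot (U ω) (X ω)) =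
      ((P.map U).prod (P.map X)).map fun p : SO d × Sph d => rot p.1 p.2 := by
    rw [← (indepFun_iff_map_prod_eq_prod_map_map hU.aemeasurable hX.aemeasurable).1 hUX,
      Measure.map_map measurable_rot (hU.prodMk hX)]
    rfl
  rw [hmap, Measure.map_apply measurable_rot hs, Measure.prod_apply (measurable_rot hs)]
  calc (ENNReal.ofReal c • nu d) s = ∫⁻ _u, (ENNReal.ofReal c • nu d) s ∂(P.map U) := by simp
    _ ≤ _ := by
      -- For each fixed `u`, the law of `rot u X` dominates the image of `c • nu` under `rot u`,
      -- which is `c • nu` itself; independence allows averaging over `u`.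
      refine lintegral_mono fun u => ?_
      refine le_trans (le_of_eq ?_) (hle _)
      rw [Measure.smul_apply, Measure.smul_apply]
      congr 1
      exact ((measurePreserving_rot u).measure_preimage hs.nullMeasurableSet).symm

theorem mul_integral_le_integral_rot {Ω : Type*} [MeasurableSpace Ω] {P : Measure Ω}
    [IsProbabilityMeasure P]
    {d : ℕ} {X : Ω → Sph d} {U : Ω → SO d} (hX : Measurable X) (hU : Measurable U)
    (hUX : IndepFun U X P) {fX : Sph d → ℝ}
    (hfX : P.map X = (nu d).withDensity fun x => ENNReal.ofReal (fX x))
    {c : ℝ} (hc0 : 0 ≤ c) (hc : ∀ x, c ≤ fX x) {h : Sph d → ℝ} (hh : Continuous h)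
    (hh0 : ∀ x, 0 ≤ h x) :
    c * ∫ z, h z ∂(nu d) ≤ ∫ ω, h (rot (U ω) (X ω)) ∂P := by
  have hm : Measurable fun ω => rot (U ω) (X ω) := by
    have h := (measurable_rot (d := d)).comp (hU.prodMk hX)
    exact h
  have hprob : IsProbabilityMeasure (P.map fun ω => rot (U ω) (X ω)) :=
    Measure.isProbabilityMeasure_map hm.aemeasurable
  have hint : Integrable h (P.map fun ω => rot (U ω) (X ω)) := integrable_sph hh
  have h1 := integral_mono_measure (smul_nu_le_map_rot hX hU hUX hfX hc)
    (.of_forall hh0) hint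
  rw [integral_smul_measure, ENNReal.toReal_ofReal hc0, smul_eq_mul,
    integral_map hm.aemeasurable hh.aestronglyMeasurable] at h1
  exact h1


/-! ### Asymptotics in the truncation level. -/

/-- An eventual lower bound for a positive sequence holds for all indices, up to a constant. -/
theorem exists_pos_mul_le_of_eventually {g M : ℕ → ℝ} (hg : ∀ n, 0 < g n) (hM : ∀ n, 0 < M n)
    {c : ℝ} (hc : 0 < c) (h : ∀ᶠ n in atTop, c * g n ≤ M n) :
    ∃ c : ℝ, 0 < c ∧ ∀ n, c * g n ≤ M n := by
  obtain ⟨N, hN⟩ := eventually_atTop.1 h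
  have hfin (N : ℕ) : ∃ c : ℝ, 0 < c ∧ ∀ n < N, c ≤ M n / g n := by
    induction N with
    | zero => exact ⟨1, one_pos, by simp⟩
    | succ k ih =>
      obtain ⟨c, hc, ih⟩ := ih
      refine ⟨min c (M k / g k), lt_min hc (div_pos (hM k) (hg k)), fun n hn => ?_⟩
      rcases Nat.lt_succ_iff_lt_or_eq.1 hn with hn | rfl
      · exact (min_le_left _ _).trans (ih n hn)
      · exact min_le_right _ _
  obtain ⟨c', hc', h'⟩ := hfin N
  refine ⟨min c c', lt_min hc hc', fun n => ?_⟩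
  rw [← le_div_iff₀ (hg n)]
  rcases lt_or_ge n N with hn | hn
  · exact (min_le_right _ _).trans (h' n hn)
  · exact (min_le_left _ _).trans ((le_div_iff₀ (hg n)).2 (hN n hn))

theorem eventually_log_add_le_mul_rpow {ε β : ℝ} (hε : 0 < ε) (hβ : 0 < β) (C : ℝ) :
    ∀ᶠ t : ℝ in atTop, Real.log t + C ≤ ε * t ^ β := by
  have h1 : ∀ᶠ t : ℝ in atTop, ‖Real.log t‖ ≤ ε / 2 * ‖t ^ β‖ :=
    (isLittleO_log_rpow_atTop hβ).bound (half_pos hε)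
  have h2 : ∀ᶠ t : ℝ in atTop, C / (ε / 2) ≤ t ^ β := (tendsto_rpow_atTop hβ).eventually_ge_atTop _
  filter_upwards [h1, h2, eventually_ge_atTop 0] with t h1 h2 h0
  rw [div_le_iff₀ (half_pos hε)] at h2
  rw [Real.norm_of_nonneg (Real.rpow_nonneg h0 β)] at h1
  linarith [Real.le_norm_self (Real.log t)]

theorem eventually_mul_le_natFloor {η : ℝ} (hη : η < 1) :
    ∀ᶠ t : ℝ in atTop, η * t ≤ (⌊t⌋₊ : ℝ) := by
  filter_upwards [eventually_ge_atTop (1 / (1 - η))] with t ht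
  rw [div_le_iff₀ (by linarith)] at ht
  linarith [Nat.lt_floor_add_one t]

/-- Widening `η` to `η'` gains `2γ(η'^β - η^β) t^β h t` in the exponent. Since `h ≥ 1`, this
dominates `log t + |q| log 2`, the cost of the extra factor `t` and of replacing `⌊t⌋` by `t`. The
function `h` covers both `1` and `log t - ζ`. -/
theorem eventually_rpow_mul_exp_le {q β γ η η' : ℝ} (hβ : 0 < β) (hγ : 0 < γ) (hη : 0 < η)
    (hηη' : η < η') {h : ℝ → ℝ} {E : ℕ → ℝ} (h1 : ∀ᶠ t in atTop, 1 ≤ h t)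
    (hE : ∀ᶠ t : ℝ in atTop, γ * (η' * t) ^ β * h t ≤ E ⌊t⌋₊) :
    ∀ᶠ t : ℝ in atTop, t ^ (q + 1) * Real.exp (2 * γ * (η * t) ^ β * h t) ≤
      (⌊t⌋₊ : ℝ) ^ q * Real.exp (2 * E ⌊t⌋₊) := by
  have hpow : η ^ β < η' ^ β := Real.rpow_lt_rpow hη.le hηη' hβ
  filter_upwards [h1, hE, eventually_mul_le_natFloor (η := 1 / 2) (by norm_num),
    eventually_ge_atTop 2,
    eventually_log_add_le_mul_rpow (ε := 2 * γ * (η' ^ β - η ^ β))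
      (by have := sub_pos.2 hpow; positivity) hβ (|q| * Real.log 2)] with t h1 hE hL ht hlog
  have ht0 : 0 < t := by linarith
  have hL0 : (0 : ℝ) < ⌊t⌋₊ := by linarith
  have hLt : (⌊t⌋₊ : ℝ) ≤ t := Nat.floor_le ht0.le
  rw [Real.rpow_def_of_pos ht0, Real.rpow_def_of_pos hL0, ← Real.exp_add, ← Real.exp_add,
    Real.exp_le_exp]
  rw [Real.mul_rpow (hη.trans hηη').le ht0.le] at hE
  rw [Real.mul_rpow hη.le ht0.le]
  have hlogL : |Real.log t - Real.log ⌊t⌋₊| ≤ Real.log 2 := by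
    rw [abs_of_nonneg (sub_nonneg.2 (Real.log_le_log hL0 hLt)), ← Real.log_div ht0.ne' hL0.ne']
    refine Real.log_le_log (by positivity) ?_
    rw [div_le_iff₀ hL0]
    linarith
  have hq : q * (Real.log t - Real.log ⌊t⌋₊) ≤ |q| * Real.log 2 :=
    (le_abs_self _).trans (by rw [abs_mul]; gcongr)
  have hmain : 2 * γ * (η' ^ β - η ^ β) * t ^ β ≤ 2 * γ * (η' ^ β - η ^ β) * t ^ β * h t :=
    le_mul_of_one_le_right (by have := sub_pos.2 hpow; positivity) h1
  nlinarith

/-- The upper half of the range has at least `⌊t⌋/2 ≥ t/4` indices, each at least `t/4`. -/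
theorem eventually_sum_rpow_ge {q : ℝ} (hq : 0 ≤ q) :
    ∀ᶠ t : ℝ in atTop, (1 / 4 : ℝ) ^ (q + 1) * t ^ (q + 1) ≤
      ∑ l ∈ Finset.Icc 1 ⌊t⌋₊, (l : ℝ) ^ q := by
  filter_upwards [eventually_mul_le_natFloor (η := 1 / 2) (by norm_num),
    eventually_ge_atTop 2] with t hL ht
  have ht0 : 0 < t := by linarith
  set L := ⌊t⌋₊
  have hL1 : 1 ≤ L := by
    have : (0 : ℝ) < L := by linarith
    exact_mod_cast this
  have h1 : ∑ l ∈ Finset.Icc (L - L / 2) L, ((1 / 4 : ℝ) * t) ^ q ≤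
      ∑ l ∈ Finset.Icc 1 L, (l : ℝ) ^ q := by
    refine (Finset.sum_le_sum fun l hl => ?_).trans (Finset.sum_le_sum_of_subset_of_nonneg
      (Finset.Icc_subset_Icc (by omega) le_rfl) fun l _ _ => by positivity)
    refine Real.rpow_le_rpow (by positivity) ?_ hq
    have h2 : L ≤ 2 * l := by have := (Finset.mem_Icc.1 hl).1; omega
    have h3 : (L : ℝ) ≤ 2 * l := by exact_mod_cast h2
    linarith
  refine le_trans ?_ h1
  rw [Finset.sum_const, Nat.card_Icc, nsmul_eq_mul, ← Real.mul_rpow (by norm_num) ht0.le,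
    Real.rpow_add_one (by positivity), mul_comm]
  gcongr
  have h4 : L ≤ 2 * (L + 1 - (L - L / 2)) := by omega
  have h5 : (L : ℝ) ≤ 2 * ((L + 1 - (L - L / 2) : ℕ) : ℝ) := by exact_mod_cast h4
  linarith

theorem sq_mul_rpow_le {d l : ℕ} (hd : d = 1 ∨ d = 2) (hl : 1 ≤ l) {c α e a : ℝ} (hc : 0 < c)
    (h : c * (l : ℝ) ^ α * Real.exp e ≤ a) :
    c ^ 2 * ((l : ℝ) ^ (2 * α + d - 1) * Real.exp (2 * e)) ≤ a ^ 2 * harmDim d l := by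
  have hl0 : (0 : ℝ) < l := by exact_mod_cast hl
  have hd1 : 1 ≤ d := by omega
  have h1 : (l : ℝ) ^ (2 * α + d - 1) = ((l : ℝ) ^ α) ^ 2 * (l : ℝ) ^ (d - 1) := by
    rw [← Real.rpow_natCast, ← Real.rpow_natCast, ← Real.rpow_mul hl0.le, ← Real.rpow_add hl0]
    congr 1
    push_cast [Nat.cast_sub hd1]
    ring
  have h2 : Real.exp (2 * e) = Real.exp e ^ 2 := by rw [← Real.exp_nat_mul]; norm_num
  have h3 : ((l : ℝ) ^ (d - 1)) ≤ harmDim d l := by exact_mod_cast pow_le_harmDim (l := l) hd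
  calc c ^ 2 * ((l : ℝ) ^ (2 * α + d - 1) * Real.exp (2 * e))
      = (c * (l : ℝ) ^ α * Real.exp e) ^ 2 * (l : ℝ) ^ (d - 1) := by rw [h1, h2]; ring
    _ ≤ a ^ 2 * harmDim d l := by gcongr

theorem invOpNorm_pos {d l : ℕ} (hd : d = 1 ∨ d = 2)
    (B : (l : ℕ) → Fin (harmDim d l) → Sph d → ℂ) (g : SO d → ℝ)
    (hinv : IsUnit (rotFourier B g l)) : 0 < invOpNorm B g l := by
  have : Nonempty (Fin (harmDim d l)) := ⟨⟨0, harmDim_pos hd⟩⟩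
  rw [invOpNorm, norm_pos_iff]
  have h : IsUnit (rotFourier B g l)⁻¹ := Matrix.isUnit_nonsing_inv_iff.2 hinv
  simpa using h.ne_zero

/-- Only the term `l = ⌊T n⌋` is kept. It carries the power `2α + d - 1`; the last unit is supplied
by `eventually_rpow_mul_exp_le`. -/
theorem exists_pos_of_single_le {S T : ℕ → ℝ} {a E : ℕ → ℝ} {d : ℕ} (hd : d = 1 ∨ d = 2)
    (hT_pos : ∀ n, 0 < T n) (hT : Tendsto T atTop atTop) (hS : ∀ n, 0 < S n)
    {κ : ℝ} (hκ : 0 < κ)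
    (hSa : ∀ n, κ * ∑ l ∈ Finset.range (⌊T n⌋₊ + 1), a l ^ 2 * harmDim d l ≤ S n)
    {c α β γ η η' : ℝ} (hc : 0 < c) (hβ : 0 < β) (hγ : 0 < γ) (hη : 0 < η) (hηη' : η < η')
    (ha : ∀ l : ℕ, 1 ≤ l → c * (l : ℝ) ^ α * Real.exp (E l) ≤ a l)
    {h : ℝ → ℝ} (h1 : ∀ᶠ t in atTop, 1 ≤ h t)
    (hE : ∀ᶠ t : ℝ in atTop, γ * (η' * t) ^ β * h t ≤ E ⌊t⌋₊) :
    ∃ c : ℝ, 0 < c ∧ ∀ n,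
      c * (T n ^ (2 * α + d) * Real.exp (2 * γ * (η * T n) ^ β * h (T n))) ≤ S n := by
  refine exists_pos_mul_le_of_eventually
    (fun n => mul_pos (Real.rpow_pos_of_pos (hT_pos n) _) (Real.exp_pos _)) hS
    (c := κ * c ^ 2) (by positivity) ?_
  have hev := hT.eventually
    (eventually_rpow_mul_exp_le (q := 2 * α + d - 1) hβ hγ hη hηη' h1 hE)
  filter_upwards [hev, hT.eventually_ge_atTop 1] with n hn hn1
  rw [sub_add_cancel] at hn
  refine le_trans ?_ (hSa n)
  rw [mul_assoc]
  refine mul_le_mul_of_nonneg_left ?_ hκ.le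
  have hL : 1 ≤ ⌊T n⌋₊ := Nat.le_floor (by exact_mod_cast hn1)
  refine (mul_le_mul_of_nonneg_left hn (sq_nonneg c)).trans
    ((sq_mul_rpow_le hd hL hc (ha _ hL)).trans ?_)
  exact Finset.single_le_sum (f := fun l => a l ^ 2 * (harmDim d l : ℝ))
    (fun l _ => by positivity) (Finset.mem_range.2 (Nat.lt_succ_self _))

/-- With no exponential to spare, one term would lose a factor `T n`, so the sum over `l` is needed.
-/
theorem exists_pos_of_sum_le {S T : ℕ → ℝ} {a : ℕ → ℝ} {d : ℕ} (hd : d = 1 ∨ d = 2)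
    (hT_pos : ∀ n, 0 < T n) (hT : Tendsto T atTop atTop) (hS : ∀ n, 0 < S n)
    {κ : ℝ} (hκ : 0 < κ)
    (hSa : ∀ n, κ * ∑ l ∈ Finset.range (⌊T n⌋₊ + 1), a l ^ 2 * harmDim d l ≤ S n)
    {c β : ℝ} (hc : 0 < c) (hβ : 0 ≤ β) (ha : ∀ l : ℕ, 1 ≤ l → c * (l : ℝ) ^ β ≤ a l) :
    ∃ c : ℝ, 0 < c ∧ ∀ n, c * T n ^ (2 * β + d) ≤ S n := by
  have hd1 : (1 : ℝ) ≤ d := by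
    have : 1 ≤ d := by omega
    exact_mod_cast this
  refine exists_pos_mul_le_of_eventually (fun n => Real.rpow_pos_of_pos (hT_pos n) _) hS
    (c := κ * (c ^ 2 * (1 / 4) ^ (2 * β + d))) (by positivity) ?_
  filter_upwards [hT.eventually (eventually_sum_rpow_ge (q := 2 * β + d - 1) (by linarith))]
    with n hn
  rw [sub_add_cancel] at hn
  refine le_trans ?_ (hSa n)
  rw [mul_assoc, mul_assoc]
  refine mul_le_mul_of_nonneg_left ?_ hκ.le
  refine (mul_le_mul_of_nonneg_left hn (sq_nonneg c)).trans ?_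
  rw [Finset.mul_sum]
  refine (Finset.sum_le_sum fun l hl => ?_).trans
    (Finset.sum_le_sum_of_subset_of_nonneg (s := Finset.Icc 1 ⌊T n⌋₊) (fun l hl => ?_)
      fun l _ _ => by positivity)
  · have hl1 := (Finset.mem_Icc.1 hl).1
    simpa using sq_mul_rpow_le hd hl1 hc (e := 0) (by simpa using ha l hl1)
  · exact Finset.mem_range.2 (Nat.lt_succ_of_le (Finset.mem_Icc.1 hl).2)

/-- The shift `log 2` comes from `⌊t⌋ ≥ t/2`; it does not depend on `η'`, so one `ζ` serves for all
`η`. -/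
theorem eventually_mul_log_le {β γ η' ξ : ℝ} (hβ : 0 < β) (hγ : 0 < γ) (hη' : 0 < η')
    (hη'1 : η' < 1) :
    ∀ᶠ t : ℝ in atTop, γ * (η' * t) ^ β * (Real.log t - (ξ + Real.log 2)) ≤
      γ * (⌊t⌋₊ : ℝ) ^ β * (Real.log ⌊t⌋₊ - ξ) := by
  filter_upwards [eventually_mul_le_natFloor (η := 1 / 2) (by norm_num),
    eventually_mul_le_natFloor hη'1, eventually_gt_atTop 0,
    Real.tendsto_log_atTop.eventually_ge_atTop (ξ + Real.log 2)] with t h1 h2 h0 h3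
  have hlog : Real.log t - Real.log 2 ≤ Real.log ⌊t⌋₊ := by
    rw [← Real.log_div h0.ne' two_ne_zero]
    exact Real.log_le_log (by positivity) (by linarith)
  have h4 : 0 ≤ Real.log t - (ξ + Real.log 2) := sub_nonneg.2 h3
  have h5 : (η' * t) ^ β ≤ (⌊t⌋₊ : ℝ) ^ β := Real.rpow_le_rpow (by positivity) h2 hβ.le
  have h6 : Real.log t - (ξ + Real.log 2) ≤ Real.log ⌊t⌋₊ - ξ := by linarith
  exact mul_le_mul (mul_le_mul_of_nonneg_left h5 hγ.le) h6 h4 (by positivity)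

end SphereDeconv

end

/-! ### Assembly of the lower bounds. -/

theorem mainTheorem9 {Ω : Type*} [MeasurableSpace Ω] (P : Measure Ω) [IsProbabilityMeasure P]
    (d : ℕ)
    (X : Ω → SphereDeconv.Sph d) (U : Ω → SphereDeconv.SO d)
    (hX : Measurable X) (hU : Measurable U) (hUX : IndepFun U X P)
    (fX : SphereDeconv.Sph d → ℝ) (hfX_meas : Measurable fX) (hfX_nonneg : ∀ x, 0 ≤ fX x)
    (hfX : P.map X = (SphereDeconv.nu d).withDensity fun x => ENNReal.ofReal (fX x))
    (hfX_sq : MemLp fX 2 (SphereDeconv.nu d))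
    (fU : SphereDeconv.SO d → ℝ) (hfU_meas : Measurable fU) (hfU_nonneg : ∀ u, 0 ≤ fU u)
    (hfU : P.map U = (SphereDeconv.haarSO d).withDensity fun u => ENNReal.ofReal (fU u))
    (hfU_sq : MemLp fU 2 (SphereDeconv.haarSO d))
    (B : (l : ℕ) → Fin (SphereDeconv.harmDim d l) → SphereDeconv.Sph d → ℂ)
    (hB : ∀ l, SphereDeconv.IsHarmonicONB d l (B l))
    (hinv : ∀ l, IsUnit (SphereDeconv.rotFourier B fU l))
    (T : ℕ → ℝ) (hT_pos : ∀ n, 0 < T n) (hT : Tendsto T atTop atTop)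
    (hA2 : ∃ c : ℝ, 0 < c ∧ ∀ x, c ≤ fX x)
    (hG : d = 1 ∨
      (d = 2 ∧ ∀ l, ∃ s : ℝ, s ≠ 0 ∧ SphereDeconv.rotFourier B fU l = (s : ℂ) • 1)) :
    (∀ n x, ∫ z, (SphereDeconv.kernelK B fU (T n) x z).im ^ 2 ∂(SphereDeconv.nu d) ≤
      ∫ z, (SphereDeconv.kernelK B fU (T n) x z).re ^ 2 ∂(SphereDeconv.nu d)) ∧
    (∀ β : ℝ, 0 ≤ β → SphereDeconv.SmoothLower1 B fU β →
      SphereDeconv.VarLower1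
        (fun n x => ∫ ω, (SphereDeconv.kernelK B fU (T n) x
          (SphereDeconv.rot (U ω) (X ω))).re ^ 2 ∂P) T β d) ∧
    (∀ α β γ : ℝ, 0 < β → 0 < γ → SphereDeconv.SmoothLower2 B fU α β γ →
      SphereDeconv.VarLower2
        (fun n x => ∫ ω, (SphereDeconv.kernelK B fU (T n) x
          (SphereDeconv.rot (U ω) (X ω))).re ^ 2 ∂P) T α β γ d) ∧
    (∀ α β γ ξ₂ : ℝ, 0 < β → 0 < γ → SphereDeconv.SmoothLower3 B fU α β γ ξ₂ →
      SphereDeconv.VarLower3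
        (fun n x => ∫ ω, (SphereDeconv.kernelK B fU (T n) x
          (SphereDeconv.rot (U ω) (X ω))).re ^ 2 ∂P) T α β γ d) := by
  have hd : d = 1 ∨ d = 2 := hG.imp id And.left
  have hd1 : 1 ≤ d := by omega
  have hg : Integrable fU (SphereDeconv.haarSO d) := hfU_sq.integrable (by norm_num)
  have hscalar (l : ℕ) : ∃ c : ℝ, 0 < c ∧ SphereDeconv.rotFourier B fU l *
      (SphereDeconv.rotFourier B fU l).conjTranspose = (c : ℂ) • 1 := by
    rcases hG with rfl | ⟨-, hs⟩
    · exact SphereDeconv.exists_rotFourier_mul_conjTranspose_one hB hg l (hinv l)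
    · obtain ⟨s, hs0, hs⟩ := hs l
      exact SphereDeconv.exists_rotFourier_mul_conjTranspose_of_eq_smul hs0 hs
  obtain ⟨c, hc, hcX⟩ := hA2
  have hν := SphereDeconv.measureReal_nu_pos d
  have hκ : 0 < c / (SphereDeconv.nu d).real Set.univ := div_pos hc hν
  have hM (x : SphereDeconv.Sph d) (n : ℕ) : c / (SphereDeconv.nu d).real Set.univ *
      ∑ l ∈ Finset.range (⌊T n⌋₊ + 1),
        SphereDeconv.invOpNorm B fU l ^ 2 * SphereDeconv.harmDim d l ≤
      ∫ ω, (SphereDeconv.kernelK B fU (T n) x (SphereDeconv.rot (U ω) (X ω))).re ^ 2 ∂P := by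
    refine le_trans ?_ (SphereDeconv.mul_integral_le_integral_rot hX hU hUX hfX hc.le hcX
      (h := fun z => (SphereDeconv.kernelK B fU (T n) x z).re ^ 2)
      ((Complex.continuous_re.comp (SphereDeconv.continuous_kernelK hB fU (T n) x)).pow 2)
      fun z => sq_nonneg _)
    rw [div_mul_eq_mul_div, div_le_iff₀ hν, mul_assoc]
    refine mul_le_mul_of_nonneg_left ?_ hc.le
    rw [mul_comm]
    exact SphereDeconv.le_integral_kernelK_re_sq hB hd1 hg hscalar (T n) x
  -- Strict positivity for every `n` is what extends the eventual bounds to all indices.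
  have hpos (x : SphereDeconv.Sph d) (n : ℕ) :
      0 < ∫ ω, (SphereDeconv.kernelK B fU (T n) x (SphereDeconv.rot (U ω) (X ω))).re ^ 2 ∂P := by
    refine lt_of_lt_of_le (mul_pos hκ (Finset.sum_pos (fun l _ => ?_) (by simp))) (hM x n)
    exact mul_pos (pow_pos (SphereDeconv.invOpNorm_pos hd B fU (hinv l)) 2)
      (by exact_mod_cast SphereDeconv.harmDim_pos hd)
  refine ⟨fun n x => ?_, fun β hβ ⟨c₂, hc₂, h⟩ x => ?_, fun α β γ hβ hγ ⟨c₂, hc₂, h⟩ x η hη hη1 => ?_,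
    fun α β γ ξ hβ hγ ⟨c₂, hc₂, h⟩ => ⟨ξ + Real.log 2, fun x η hη hη1 => ?_⟩⟩
  · simp only [SphereDeconv.kernelK_im hB hg]
    simp only [ne_eq, OfNat.ofNat_ne_zero, not_false_eq_true, zero_pow, integral_zero]
    exact integral_nonneg fun z => sq_nonneg _
  · exact SphereDeconv.exists_pos_of_sum_le hd hT_pos hT (hpos x) hκ (hM x) hc₂ hβ h
  -- The midpoint `(1 + η)/2` leaves room on both sides: below `1` for the floor, above `η` for the
  -- polynomial factor.
  · have hE : ∀ᶠ t : ℝ in atTop, γ * ((1 + η) / 2 * t) ^ β * 1 ≤ γ * (⌊t⌋₊ : ℝ) ^ β := by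
      filter_upwards [SphereDeconv.eventually_mul_le_natFloor (η := (1 + η) / 2) (by linarith),
        eventually_ge_atTop 0] with t ht ht0
      rw [mul_one]
      exact mul_le_mul_of_nonneg_left
        (Real.rpow_le_rpow (by positivity) ht hβ.le) hγ.le
    have h2 := SphereDeconv.exists_pos_of_single_le (h := fun _ => 1)
      (E := fun l => γ * (l : ℝ) ^ β) hd hT_pos hT (hpos x) hκ
      (hM x) hc₂ hβ hγ hη (η' := (1 + η) / 2) (by linarith) h (.of_forall fun _ => le_rfl) hE
    simpa only [mul_one] using h2
  · refine SphereDeconv.exists_pos_of_single_le (h := fun t => Real.log t - (ξ + Real.log 2))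
      (E := fun l => γ * (l : ℝ) ^ β * (Real.log l - ξ)) hd hT_pos hT (hpos x) hκ
      (hM x) hc₂ hβ hγ hη (η' := (1 + η) / 2) (by linarith) h ?_
      (SphereDeconv.eventually_mul_log_le hβ hγ (by linarith) (by linarith))
    filter_upwards [Real.tendsto_log_atTop.eventually_ge_atTop (1 + (ξ + Real.log 2))] with t ht
    linarith
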